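/- Let $G=(V,E)$ be a finite simple graph that is amply regular with parameters $(n,d,\alpha,1)$, that is: $G$ is connected, not complete, $d$-regular on $n$ vertices, any two adjacent vertices have exactly $\alpha$ common neighbours, and any two vertices at distance $2$ have exactly one common neighbour. For $x\in V$ and $p\in[0,1]$ let $\mu_x^p$ be the probability measure on $V$ with mass $p$ at $x$, mass $\frac{1-p}{\deg x}$ at each neighbour of $x$, and mass $0$ elsewhere. Let $$W_1(\mu,\nu)=\inf_\pi\sum_{u,v\in V}d(u,v)\,\pi(u,v),$$ where $d(\cdot,\cdot)$ is the combinatorial distance and $\pi$ runs over all maps $V\times V\to[0,1]$ with marginals $\mu$ and $\nu$. The Lin–Lu–Yau curvature of an edge $xy$ is $$\kappa(x,y)=\lim_{p\to1^-}\frac{1}{1-p}\left(1-\frac{W_1(\mu_x^p,\mu_y^p)}{d(x,y)}\right).$$ If $\kappa(x,y)>0$ for every edge $xy\in E$, then $G$ is isomorphic to one of the following graphs: the pentagon, the line graph of the Petersen graph, the line graph of the Hoffman–Singleton graph, or the line graph of a strongly regular graph with parameters $(3250,57,0,1)$ (that is, of a $57$-regular graph on $3250$ vertices in which adjacent vertices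 have no common neighbour and any two distinct non-adjacent vertices have exactly one common neighbour). -/

import Mathlib

namespace LLY

open Filter Topology

noncomputable section

/-- A transport plan between two mass distributions `μ₁`, `μ₂` on a finite vertex set: a map
`π : V × V → [0,1]` with marginals `μ₁` and `μ₂`. -/
structure IsTransportPlan {V : Type*} [Fintype V] (μ₁ μ₂ : V → ℝ) (π : V → V → ℝ) : Prop where
  nonneg : ∀ x y, 0 ≤ π x y
  le_one : ∀ x y, π x y ≤ 1
  fst_marginal : ∀ x, ∑ y, π x y = μ₁ x
  snd_marginal : ∀ y, ∑ x, π x y = μ₂ y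

/-- The cost of a plan with respect to the combinatorial distance of `G`. -/
def transportCost {V : Type*} [Fintype V] (G : SimpleGraph V) (π : V → V → ℝ) : ℝ :=
  ∑ x, ∑ y, (G.dist x y : ℝ) * π x y

/-- The Wasserstein distance `W₁` on `G`: the infimum of the costs of all transport plans. -/
def wasserstein {V : Type*} [Fintype V] (G : SimpleGraph V) (μ₁ μ₂ : V → ℝ) : ℝ :=
  sInf {c : ℝ | ∃ π : V → V → ℝ, IsTransportPlan μ₁ μ₂ π ∧ c = transportCost G π}

open Classical in
/-- The measure `μ_x^p`: mass `p` at `x` and mass `(1 - p) / deg x` at each neighbour of `x`. -/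
def ballMeasure {V : Type*} [Fintype V] (G : SimpleGraph V) (p : ℝ) (x y : V) : ℝ :=
  if y = x then p else if G.Adj x y then (1 - p) / (G.degree x : ℝ) else 0

/-- The `p`-Ollivier curvature `κ_p(x,y)`. -/
def ollivierCurvature {V : Type*} [Fintype V] (G : SimpleGraph V) (p : ℝ) (x y : V) : ℝ :=
  1 - wasserstein G (ballMeasure G p x) (ballMeasure G p y) / (G.dist x y : ℝ)

/-- The Lin–Lu–Yau curvature `κ(x,y) = lim_{p → 1⁻} κ_p(x,y) / (1 - p)`. The limit exists for
adjacent `x`, `y`: see `tendsto_curvature`. -/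
def curvature {V : Type*} [Fintype V] (G : SimpleGraph V) (x y : V) : ℝ :=
  limUnder (𝓝[<] (1 : ℝ)) (fun p : ℝ => ollivierCurvature G p x y / (1 - p))

/-- `G` has positive Lin–Lu–Yau curvature: `κ(x,y) > 0` for every edge `xy`. -/
def HasPositiveCurvature {V : Type*} [Fintype V] (G : SimpleGraph V) : Prop :=
  ∀ x y : V, G.Adj x y → 0 < curvature G x y

section LimitExists

variable {V : Type*} [Fintype V] {G : SimpleGraph V}

lemma ballMeasure_nonneg {p : ℝ} (h0 : 0 ≤ p) (h1 : p ≤ 1) (x y : V) :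
    0 ≤ ballMeasure G p x y := by
  unfold ballMeasure
  have : 0 ≤ 1 - p := by linarith
  split_ifs <;> positivity

open Classical in
lemma sum_ballMeasure {p : ℝ} {x z : V} (h : G.Adj x z) : ∑ y, ballMeasure G p x y = 1 := by
  have hd : (G.degree x : ℝ) ≠ 0 := by
    have : 0 < G.degree x := (G.degree_pos_iff_exists_adj x).2 ⟨z, h⟩
    positivity
  have key : ∀ y, ballMeasure G p x y =
      (if y = x then p else 0) + (if G.Adj x y then (1 - p) / (G.degree x : ℝ) else 0) := by
    intro y
    unfold ballMeasure
    by_cases hy : y = x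
    · subst hy; simp
    · simp [hy]
  simp only [key, Finset.sum_add_distrib]
  rw [Finset.sum_ite_eq' Finset.univ x, ← Finset.sum_filter]
  have hc : (Finset.univ.filter (fun y => G.Adj x y)).card = G.degree x := by
    rw [← G.card_neighborFinset_eq_degree]
    congr 1
    ext y
    simp
  rw [Finset.sum_const, hc, nsmul_eq_mul]
  field_simp
  simp

lemma transportCost_nonneg {μ₁ μ₂ : V → ℝ} {π : V → V → ℝ} (h : IsTransportPlan μ₁ μ₂ π) :
    0 ≤ transportCost G π :=
  Finset.sum_nonneg fun x _ => Finset.sum_nonneg fun y _ =>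
    mul_nonneg (Nat.cast_nonneg _) (h.nonneg x y)

lemma wasserstein_le {μ₁ μ₂ : V → ℝ} {π : V → V → ℝ} (h : IsTransportPlan μ₁ μ₂ π) :
    wasserstein G μ₁ μ₂ ≤ transportCost G π :=
  csInf_le ⟨0, by rintro c ⟨π', h', rfl⟩; exact transportCost_nonneg h'⟩ ⟨π, h, rfl⟩

lemma exists_plan {p : ℝ} (h0 : 0 ≤ p) (h1 : p ≤ 1) {x y : V} (h : G.Adj x y) :
    ∃ π, IsTransportPlan (ballMeasure G p x) (ballMeasure G p y) π := by
  have hle : ∀ {u v : V}, G.Adj u v → ∀ w, ballMeasure G p u w ≤ 1 := fun {u v} huv w => by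
    rw [← sum_ballMeasure (p := p) huv]
    exact Finset.single_le_sum (fun i _ => ballMeasure_nonneg h0 h1 u i) (Finset.mem_univ w)
  refine ⟨fun u v => ballMeasure G p x u * ballMeasure G p y v, ?_, ?_, ?_, ?_⟩
  · exact fun u v => mul_nonneg (ballMeasure_nonneg h0 h1 _ _) (ballMeasure_nonneg h0 h1 _ _)
  · exact fun u v => mul_le_one₀ (hle h u) (ballMeasure_nonneg h0 h1 _ _) (hle h.symm v)
  · intro u; rw [← Finset.mul_sum, sum_ballMeasure h.symm, mul_one]
  · intro v; rw [← Finset.sum_mul, sum_ballMeasure h, one_mul]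

lemma exists_plan_lt {p : ℝ} (h0 : 0 ≤ p) (h1 : p ≤ 1) {x y : V} (h : G.Adj x y) {ε : ℝ}
    (hε : 0 < ε) : ∃ π, IsTransportPlan (ballMeasure G p x) (ballMeasure G p y) π ∧
      transportCost G π < wasserstein G (ballMeasure G p x) (ballMeasure G p y) + ε := by
  obtain ⟨π₀, hπ₀⟩ := exists_plan h0 h1 h
  obtain ⟨c, ⟨π, hπ, rfl⟩, hc⟩ := exists_lt_of_csInf_lt (s := {c : ℝ | ∃ π : V → V → ℝ,
    IsTransportPlan (ballMeasure G p x) (ballMeasure G p y) π ∧ c = transportCost G π})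
    ⟨_, π₀, hπ₀, rfl⟩ (lt_add_of_pos_right _ hε)
  exact ⟨π, hπ, hc⟩

lemma two_mul_sub_one_le_wasserstein {p : ℝ} (h0 : 0 ≤ p) (h1 : p ≤ 1) {x y : V}
    (h : G.Adj x y) :
    2 * p - 1 ≤ wasserstein G (ballMeasure G p x) (ballMeasure G p y) := by
  classical
  obtain ⟨π₀, hπ₀⟩ := exists_plan h0 h1 h
  refine le_csInf ⟨_, π₀, hπ₀, rfl⟩ ?_
  rintro c ⟨π, hπ, rfl⟩
  have e1 : π x y ≤ transportCost G π := by
    have a1 : (G.dist x y : ℝ) * π x y ≤ ∑ v, (G.dist x v : ℝ) * π x v :=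
      Finset.single_le_sum (f := fun v => (G.dist x v : ℝ) * π x v)
        (fun v _ => mul_nonneg (Nat.cast_nonneg _) (hπ.nonneg x v)) (Finset.mem_univ y)
    have a2 : ∑ v, (G.dist x v : ℝ) * π x v ≤ transportCost G π :=
      Finset.single_le_sum (f := fun u => ∑ v, (G.dist u v : ℝ) * π u v)
        (fun u _ => Finset.sum_nonneg fun v _ => mul_nonneg (Nat.cast_nonneg _) (hπ.nonneg u v))
        (Finset.mem_univ x)
    rw [SimpleGraph.dist_eq_one_iff_adj.2 h] at a1
    push_cast at a1
    linarith
  have e2 : ∑ v ∈ Finset.univ.erase y, π x v ≤ 1 - p := by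
    calc ∑ v ∈ Finset.univ.erase y, π x v
        ≤ ∑ v ∈ Finset.univ.erase y, ballMeasure G p y v := by
          refine Finset.sum_le_sum fun v _ => ?_
          rw [← hπ.snd_marginal v]
          exact Finset.single_le_sum (f := fun u => π u v) (fun u _ => hπ.nonneg u v)
            (Finset.mem_univ x)
      _ = 1 - p := by
          have := Finset.add_sum_erase Finset.univ (ballMeasure G p y) (Finset.mem_univ y)
          rw [sum_ballMeasure h.symm] at this
          have hp : ballMeasure G p y y = p := by simp [ballMeasure]
          linarith
  have e3 := Finset.add_sum_erase Finset.univ (π x) (Finset.mem_univ y)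
  rw [hπ.fst_marginal x] at e3
  have hp : ballMeasure G p x x = p := by simp [ballMeasure]
  linarith

lemma wasserstein_segment {p t : ℝ} (h0 : 0 ≤ p) (h1 : p ≤ 1) (t0 : 0 ≤ t) (t1 : t ≤ 1)
    {x y : V} (h : G.Adj x y) :
    wasserstein G (ballMeasure G ((1 - t) * p + t) x) (ballMeasure G ((1 - t) * p + t) y) ≤
      (1 - t) * wasserstein G (ballMeasure G p x) (ballMeasure G p y) + t := by
  classical
  refine le_of_forall_pos_le_add fun ε hε => ?_
  obtain ⟨π, hπ, hc⟩ := exists_plan_lt h0 h1 h hε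
  have hball : ∀ u v : V, ballMeasure G ((1 - t) * p + t) u v =
      (1 - t) * ballMeasure G p u v + t * (if v = u then 1 else 0) := by
    intro u v
    unfold ballMeasure
    split_ifs <;> ring
  let δ : V → V → ℝ := fun u v => if u = x then (if v = y then 1 else 0) else 0
  have hplan : IsTransportPlan (ballMeasure G ((1 - t) * p + t) x)
      (ballMeasure G ((1 - t) * p + t) y) (fun u v => (1 - t) * π u v + t * δ u v) := by
    have ht : 0 ≤ 1 - t := by linarith
    have d0 : ∀ u v, 0 ≤ δ u v := fun u v => by dsimp only [δ]; split_ifs <;> norm_num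
    have d1 : ∀ u v, δ u v ≤ 1 := fun u v => by dsimp only [δ]; split_ifs <;> norm_num
    refine ⟨fun u v => ?_, fun u v => ?_, fun u => ?_, fun v => ?_⟩
    · exact add_nonneg (mul_nonneg ht (hπ.nonneg u v)) (mul_nonneg t0 (d0 u v))
    · have b1 := mul_le_mul_of_nonneg_left (hπ.le_one u v) ht
      have b2 := mul_le_mul_of_nonneg_left (d1 u v) t0
      linarith
    · rw [Finset.sum_add_distrib, ← Finset.mul_sum, ← Finset.mul_sum, hπ.fst_marginal, hball]
      by_cases hu : u = x <;> simp [δ, hu]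
    · rw [Finset.sum_add_distrib, ← Finset.mul_sum, ← Finset.mul_sum, hπ.snd_marginal, hball]
      simp [δ]
  have hcost : transportCost G (fun u v => (1 - t) * π u v + t * δ u v) =
      (1 - t) * transportCost G π + t := by
    have hδ : ∑ u, ∑ v, (G.dist u v : ℝ) * δ u v = 1 := by
      have hd := SimpleGraph.dist_eq_one_iff_adj.2 h
      rw [Finset.sum_eq_single x, Finset.sum_eq_single y]
      · simp [δ, hd]
      · intro v _ hv; simp [δ, hv]
      · simp
      · intro u _ hu; simp [δ, hu]
      · simp
    have hsplit : transportCost G (fun u v => (1 - t) * π u v + t * δ u v) =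
        (1 - t) * transportCost G π + t * ∑ u, ∑ v, (G.dist u v : ℝ) * δ u v := by
      simp only [transportCost, Finset.mul_sum, ← Finset.sum_add_distrib]
      exact Finset.sum_congr rfl fun u _ => Finset.sum_congr rfl fun v _ => by ring
    rw [hsplit, hδ, mul_one]
  have hw := wasserstein_le (G := G) hplan
  rw [hcost] at hw
  nlinarith

/-- For an edge `xy`, the limit defining the Lin–Lu–Yau curvature exists. -/
theorem tendsto_curvature {x y : V} (h : G.Adj x y) :
    Tendsto (fun p : ℝ => ollivierCurvature G p x y / (1 - p)) (𝓝[<] (1 : ℝ))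
      (𝓝 (curvature G x y)) := by
  set f : ℝ → ℝ := fun p => ollivierCurvature G p x y / (1 - p) with hf
  have hK : ∀ p, ollivierCurvature G p x y =
      1 - wasserstein G (ballMeasure G p x) (ballMeasure G p y) := by
    intro p
    simp [ollivierCurvature, SimpleGraph.dist_eq_one_iff_adj.2 h]
  have hmono : MonotoneOn f (Set.Ioo 0 1) := by
    intro p hp q hq hpq
    have hp1 : 0 < 1 - p := by linarith [hp.2]
    have hq1 : 0 < 1 - q := by linarith [hq.2]
    have ht : (1 - (q - p) / (1 - p)) * p + (q - p) / (1 - p) = q := by field_simp; ring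
    have hw := wasserstein_segment (t := (q - p) / (1 - p)) hp.1.le hp.2.le
      (div_nonneg (by linarith) hp1.le) ((div_le_one hp1).2 (by linarith [hq.2])) h
    rw [ht] at hw
    simp only [hf, hK]
    rw [div_le_div_iff₀ hp1 hq1]
    have e : (q - p) / (1 - p) * (1 - p) = q - p := div_mul_cancel₀ _ hp1.ne'
    have hw2 := mul_le_mul_of_nonneg_right hw hp1.le
    have e2 : ((1 - (q - p) / (1 - p)) *
        wasserstein G (ballMeasure G p x) (ballMeasure G p y) + (q - p) / (1 - p)) * (1 - p) =
        (1 - q) * wasserstein G (ballMeasure G p x) (ballMeasure G p y) + (q - p) := by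
      field_simp
      ring
    rw [e2] at hw2
    nlinarith
  have hbdd : BddAbove (f '' Set.Ioo 0 1) := by
    refine ⟨2, ?_⟩
    rintro _ ⟨p, hp, rfl⟩
    have hp1 : 0 < 1 - p := by linarith [hp.2]
    simp only [hf, hK]
    rw [div_le_iff₀ hp1]
    linarith [two_mul_sub_one_le_wasserstein hp.1.le hp.2.le h]
  have hlim := hmono.tendsto_nhdsWithin_Ioo_left (by simp) hbdd
  exact tendsto_nhds_limUnder ⟨_, hlim⟩

end LimitExists

end

/-- `G` is amply regular with parameters `(n, d, α, β)`: a connected non-complete `d`-regular graph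
on `n` vertices in which adjacent vertices have exactly `α` common neighbours and vertices at
distance two have exactly `β` common neighbours. -/
structure IsAmplyRegularWith {V : Type*} [Fintype V] (G : SimpleGraph V) [DecidableRel G.Adj]
    (n d α β : ℕ) : Prop where
  connected : G.Connected
  not_complete : G ≠ ⊤
  card : Fintype.card V = n
  regular : G.IsRegularOfDegree d
  of_adj : ∀ x y, G.Adj x y → Fintype.card (G.commonNeighbors x y) = α
  of_dist_two : ∀ x y, G.dist x y = 2 → Fintype.card (G.commonNeighbors x y) = β

/-- The Petersen graph: a pentagon `inl j` and a pentagram `inr j`, joined by the spokes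
`inl j ~ inr j`. -/
def petersenGraph : SimpleGraph (ZMod 5 ⊕ ZMod 5) where
  Adj
    | .inl j, .inl j' => j' = j + 1 ∨ j = j' + 1
    | .inr k, .inr k' => k' = k + 2 ∨ k = k' + 2
    | .inl j, .inr k => k = j
    | .inr k, .inl j => k = j
  symm := ⟨by
    rintro (j | k) (j' | k') h
    · exact h.symm
    · exact h
    · exact h
    · exact h.symm⟩
  loopless := ⟨by rintro (j | k) h <;> revert h <;> revert ‹ZMod 5› <;> decide⟩

/-- The Hoffman–Singleton graph, in Robertson's construction: five pentagons `P_h`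
(vertices `inl (h, j)`) and five pentagrams `Q_i` (vertices `inr (i, k)`), where vertex `j` of `P_h`
is joined to vertex `h * i + j` of `Q_i`. -/
def hoffmanSingletonGraph : SimpleGraph ((ZMod 5 × ZMod 5) ⊕ (ZMod 5 × ZMod 5)) where
  Adj
    | .inl (h, j), .inl (h', j') => h = h' ∧ (j' = j + 1 ∨ j = j' + 1)
    | .inr (i, k), .inr (i', k') => i = i' ∧ (k' = k + 2 ∨ k = k' + 2)
    | .inl (h, j), .inr (i, k) => k = h * i + j
    | .inr (i, k), .inl (h, j) => k = h * i + j
  symm := ⟨by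
    rintro (⟨h, j⟩ | ⟨i, k⟩) (⟨h', j'⟩ | ⟨i', k'⟩) hadj
    · exact ⟨hadj.1.symm, hadj.2.symm⟩
    · exact hadj
    · exact hadj
    · exact ⟨hadj.1.symm, hadj.2.symm⟩⟩
  loopless := ⟨by
    rintro (⟨h, j⟩ | ⟨i, k⟩) hadj
    · have h2 := hadj.2
      clear hadj
      revert j
      decide
    · have h2 := hadj.2
      clear hadj
      revert k
      decide⟩

end LLY

/-! Call a neighbour of `x` private with respect to an edge `xy` if it is neither `y` nor adjacent
to `y`; there are `d - 1 - α` of them. Since `β = 1`, private neighbours of `x` and of `y` are never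
adjacent. Weak Kantorovich duality with suitable potentials turns positive curvature into `2 (d - 1
- α) + f ≤ d`, where `f` counts the private neighbours of `x` at distance at least three from all
those of `y`. As `β = 1` also forces at least `α + 1` private neighbours on some edge, `d = 2 (α +
1)` and `f = 0` (`degree_eq`, `exists_partner`).

The degree makes every neighbourhood a union of two cliques. Hence every vertex lies on exactly two
lines (an edge together with its common neighbours), and `G` is the line graph of the intersection
graph of its lines. That graph has no triangle or 4-cycle because `β = 1`, and diameter at most two
because `f = 0`: it is a Moore graph of degree `α + 2` (`exists_moore`).

The trace of a spectral projection restricts the degree of a Moore graph to 2, 3, 7, 57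
(`degree_mem`). In degrees 2 and 3 a pentagon and its outer neighbours determine the graph. In
degree 7 the outer neighbours of a pentagon form half of the vertices; the multiplicity 28 of the
eigenvalue 2 splits both halves into five pentagons, and the matchings between them can be
normalized to Robertson's multiplication table. -/

namespace LLY

open Filter Topology

/-! ### Positive curvature through dual potentials -/

section Curvature

variable {V : Type*} [Fintype V] {G : SimpleGraph V} [DecidableRel G.Adj] {d : ℕ}

lemma ballMeasure_of_regular [DecidableEq V] (hreg : G.IsRegularOfDegree d) (p : ℝ) (x y : V) :
    ballMeasure G p x y =
      (if y = x then p else 0) + (1 - p) / d * (if G.Adj x y then 1 else 0) := by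
  -- The degree in `ballMeasure` uses a classical `Fintype` instance, hence the quantification over
  -- instances.
  have hd : ∀ inst : Fintype (G.neighborSet x), @SimpleGraph.degree V G x inst = d := by
    intro inst
    rw [← hreg x]
    congr!
  unfold ballMeasure
  rw [hd]
  by_cases h : y = x
  · subst h; simp
  · simp [h]

lemma sum_mul_ballMeasure (hreg : G.IsRegularOfDegree d) (p : ℝ) (x : V) (φ : V → ℝ) :
    ∑ u, φ u * ballMeasure G p x u =
      φ x * p + (1 - p) / d * ∑ u ∈ G.neighborFinset x, φ u := by
  classical
  simp only [ballMeasure_of_regular hreg, mul_add, Finset.sum_add_distrib]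
  congr 1
  · simp
  · rw [SimpleGraph.neighborFinset_eq_filter, Finset.sum_filter, Finset.mul_sum]
    exact Finset.sum_congr rfl fun u _ => by split_ifs <;> ring

omit [DecidableRel G.Adj] in
/-- The easy half of Kantorovich duality. -/
lemma sub_le_transportCost {μ ν : V → ℝ} {π : V → V → ℝ} (hπ : IsTransportPlan μ ν π)
    (φ ψ : V → ℝ) (h : ∀ u v, μ u ≠ 0 → ν v ≠ 0 → φ u - ψ v ≤ G.dist u v) :
    ∑ u, φ u * μ u - ∑ v, ψ v * ν v ≤ transportCost G π := by
  have h1 : ∑ u, φ u * μ u = ∑ u, ∑ v, φ u * π u v :=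
    Finset.sum_congr rfl fun u _ => by rw [← hπ.fst_marginal u, Finset.mul_sum]
  have h2 : ∑ v, ψ v * ν v = ∑ u, ∑ v, ψ v * π u v := by
    rw [Finset.sum_comm]
    exact Finset.sum_congr rfl fun v _ => by rw [← hπ.snd_marginal v, Finset.mul_sum]
  rw [h1, h2, transportCost, ← Finset.sum_sub_distrib]
  refine Finset.sum_le_sum fun u _ => ?_
  rw [← Finset.sum_sub_distrib]
  refine Finset.sum_le_sum fun v _ => ?_
  rw [← sub_mul]
  -- A positive entry of `π` makes both marginals nonzero there, so the constraint on the potentials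
  -- is needed only on the supports.
  rcases (hπ.nonneg u v).eq_or_lt with h0 | h0
  · simp [← h0]
  · refine mul_le_mul_of_nonneg_right (h u v ?_ ?_) h0.le
    · have := Finset.single_le_sum (f := fun v => π u v) (fun v _ => hπ.nonneg u v)
        (Finset.mem_univ v)
      rw [hπ.fst_marginal] at this
      exact (h0.trans_le this).ne'
    · have := Finset.single_le_sum (f := fun u => π u v) (fun u _ => hπ.nonneg u v)
        (Finset.mem_univ u)
      rw [hπ.snd_marginal] at this
      exact (h0.trans_le this).ne'

/-- Potentials on the unit balls around the ends of a positively curved edge. -/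
lemma sum_sub_sum_lt_of_curvature_pos (hreg : G.IsRegularOfDegree d) {x y : V} (hxy : G.Adj x y)
    (φ ψ : V → ℝ) (hφψ : φ x - ψ y = 1)
    (h : ∀ u v, (u = x ∨ G.Adj x u) → (v = y ∨ G.Adj y v) → φ u - ψ v ≤ G.dist u v)
    (hκ : 0 < curvature G x y) :
    ∑ u ∈ G.neighborFinset x, φ u - ∑ v ∈ G.neighborFinset y, ψ v < d := by
  classical
  have hd : 0 < (d : ℝ) := by
    rw [← hreg x]
    exact_mod_cast (G.degree_pos_iff_exists_adj x).2 ⟨y, hxy⟩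
  set S := ∑ u ∈ G.neighborFinset x, φ u - ∑ v ∈ G.neighborFinset y, ψ v with hS
  have supp : ∀ p (u v : V), ballMeasure G p u v ≠ 0 → v = u ∨ G.Adj u v := by
    intro p u v hne
    by_contra hc
    push Not at hc
    exact hne (by simp [ballMeasure, hc.1, hc.2])
  -- Duality gives `W₁ ≥ p + (1 - p) S / d`, the coefficient of `p` being `φ x - ψ y = 1`. The
  -- resulting bound on the quotient does not depend on `p` and passes to the limit.
  have key : ∀ p ∈ Set.Ioo (0 : ℝ) 1, ollivierCurvature G p x y / (1 - p) ≤ 1 - S / d := by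
    intro p hp
    have hp1 : 0 < 1 - p := by linarith [hp.2]
    have hW : p + (1 - p) / d * S ≤
        wasserstein G (ballMeasure G p x) (ballMeasure G p y) := by
      obtain ⟨π₀, hπ₀⟩ := exists_plan hp.1.le hp.2.le hxy
      refine le_csInf ⟨_, π₀, hπ₀, rfl⟩ ?_
      rintro c ⟨π, hπ, rfl⟩
      refine le_trans (le_of_eq ?_) (sub_le_transportCost hπ φ ψ fun u v hu hv =>
        h u v (supp _ _ _ hu) (supp _ _ _ hv))
      rw [sum_mul_ballMeasure hreg, sum_mul_ballMeasure hreg, hS]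
      linear_combination -p * hφψ
    rw [div_le_iff₀ hp1, ollivierCurvature, SimpleGraph.dist_eq_one_iff_adj.2 hxy]
    push_cast
    have : (1 - S / d) * (1 - p) = 1 - (p + (1 - p) / d * S) := by ring
    rw [this, div_one]
    linarith
  have hle : curvature G x y ≤ 1 - S / d := by
    refine le_of_tendsto (tendsto_curvature hxy) ?_
    filter_upwards [Ioo_mem_nhdsLT (show (0 : ℝ) < 1 by norm_num)] with p hp using key p hp
  have : S / d < 1 := by linarith
  rwa [div_lt_one hd] at this

end Curvature

end LLY

namespace LLY

/-! ### Local structure of positively curved amply regular graphs -/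

section AmplyRegular

variable {V : Type*} {G : SimpleGraph V}

/-- Non-adjacent vertices have at most one common neighbour. -/
def AtMostOneCommon (G : SimpleGraph V) : Prop :=
  ∀ a c u v, a ≠ c → ¬G.Adj a c → G.Adj u a → G.Adj u c → G.Adj v a → G.Adj v c → u = v

lemma common_iff_dist_eq_two (hc : G.Connected) {a c : V} :
    G.dist a c = 2 ↔ a ≠ c ∧ ¬G.Adj a c ∧ ∃ u, G.Adj u a ∧ G.Adj u c := by
  have : G.dist a c = 2 ↔ G.edist a c = 2 := by
    rw [← (hc a c).coe_dist_eq_edist]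
    norm_cast
  rw [this, SimpleGraph.edist_eq_two_iff]
  simp [Set.Nonempty, SimpleGraph.mem_commonNeighbors, SimpleGraph.adj_comm]

variable [Fintype V] [DecidableRel G.Adj] {n d α : ℕ}

lemma IsAmplyRegularWith.atMostOneCommon (hG : IsAmplyRegularWith G n d α 1) :
    AtMostOneCommon G := by
  intro a c u v hac hnadj hua huc hva hvc
  have h2 := hG.of_dist_two a c ((common_iff_dist_eq_two hG.connected).2 ⟨hac, hnadj, u, hua, huc⟩)
  obtain ⟨w, hw⟩ := Fintype.card_eq_one_iff.1 h2
  have e1 := hw ⟨u, hua.symm, huc.symm⟩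
  have e2 := hw ⟨v, hva.symm, hvc.symm⟩
  exact congrArg Subtype.val (e1.trans e2.symm)

/-- The neighbours of `x` that are neither equal nor adjacent to `y`. -/
def privateNeighbors [DecidableEq V] (G : SimpleGraph V) [DecidableRel G.Adj] (x y : V) :
    Finset V :=
  (G.neighborFinset x).filter fun z => z ≠ y ∧ ¬G.Adj y z

variable [DecidableEq V]

lemma mem_privateNeighbors {x y z : V} :
    z ∈ privateNeighbors G x y ↔ G.Adj x z ∧ z ≠ y ∧ ¬G.Adj y z := by
  simp [privateNeighbors]

omit [DecidableEq V] in
lemma card_common_finset (hα : ∀ x y, G.Adj x y → Fintype.card (G.commonNeighbors x y) = α)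
    {x y : V} (hxy : G.Adj x y) :
    ((G.neighborFinset x).filter fun z => G.Adj y z).card = α := by
  rw [← hα x y hxy, ← Set.toFinset_card]
  congr 1
  ext z
  simp [SimpleGraph.mem_commonNeighbors]

lemma card_privateNeighbors (hreg : G.IsRegularOfDegree d)
    (hα : ∀ x y, G.Adj x y → Fintype.card (G.commonNeighbors x y) = α)
    {x y : V} (hxy : G.Adj x y) : (privateNeighbors G x y).card + 1 + α = d := by
  have h1 := card_common_finset hα hxy
  have h2 : G.neighborFinset x = privateNeighbors G x y ∪
      ({y} ∪ (G.neighborFinset x).filter fun z => G.Adj y z) := by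
    ext z
    simp only [SimpleGraph.mem_neighborFinset, Finset.mem_union, mem_privateNeighbors,
      Finset.mem_singleton, Finset.mem_filter]
    constructor
    · intro h; tauto
    · rintro (h | rfl | h)
      exacts [h.1, hxy, h.1]
  have h3 := congrArg Finset.card h2
  rw [SimpleGraph.card_neighborFinset_eq_degree, hreg x, Finset.card_union_of_disjoint,
    Finset.card_union_of_disjoint, h1, Finset.card_singleton] at h3
  · omega
  · simp
  · rw [Finset.disjoint_left]
    intro z hz
    rw [mem_privateNeighbors] at hz
    simp [hz.2.1, hz.2.2]

/-- Optimal potentials for the transport between the unit balls around `x` and `y`, where `A` is a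
set of private neighbours of `x` at distance at least three from all those of `y`. -/
lemma IsAmplyRegularWith.potential_sub_le (hG : IsAmplyRegularWith G n d α 1) {x y : V}
    (hxy : G.Adj x y) {A : Finset V} (hAsub : ∀ u ∈ A, u ∈ privateNeighbors G x y)
    (hA : ∀ u ∈ A, ∀ q ∈ privateNeighbors G y x, 3 ≤ G.dist u q) {u v : V}
    (hu : u = x ∨ G.Adj x u) (hv : v = y ∨ G.Adj y v) :
    ((1 : ℝ) + (if u = x then 1 else 0) + (if u ∈ privateNeighbors G x y then 1 else 0) +
      (if u ∈ A then 1 else 0)) -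
    (1 + (if v = x then 1 else 0) - (if v ∈ privateNeighbors G y x then 1 else 0)) ≤
      G.dist u v := by
  -- The first potential is 3 on `A`, 2 at `x` and at the other private neighbours of `x`, and 1
  -- elsewhere; the second is 0 on the private neighbours of `y`, 2 at `x`, and 1 elsewhere. A
  -- difference of 3 thus occurs only from `A` to private neighbours of `y`.
  have hU := hG.atMostOneCommon
  have d0 : (0 : ℝ) ≤ G.dist u v := Nat.cast_nonneg _
  have d1 : u ≠ v → (1 : ℝ) ≤ G.dist u v := fun h => by
    exact_mod_cast hG.connected.pos_dist_of_ne h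
  have d2 : u ≠ v → ¬G.Adj u v → (2 : ℝ) ≤ G.dist u v := fun h h' => by
    exact_mod_cast hG.connected.one_lt_dist_of_ne_of_not_adj h h'
  have hxN : x ∉ privateNeighbors G x y := by simp [mem_privateNeighbors]
  have hxN' : x ∉ privateNeighbors G y x := by simp [mem_privateNeighbors]
  by_cases hvN : v ∈ privateNeighbors G y x
  · have hvx : v ≠ x := fun h => hxN' (h ▸ hvN)
    obtain ⟨b1, b2, b3⟩ := mem_privateNeighbors.1 hvN
    by_cases huA : u ∈ A
    · have huN := hAsub u huA
      have hux : u ≠ x := fun h => hxN (h ▸ huN)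
      have : (3 : ℝ) ≤ G.dist u v := by exact_mod_cast hA u huA v hvN
      simp only [hux, hvx, hvN, huA, huN, if_true, if_false]
      linarith
    by_cases huN : u ∈ privateNeighbors G x y
    · obtain ⟨a1, a2, a3⟩ := mem_privateNeighbors.1 huN
      have hux : u ≠ x := fun h => hxN (h ▸ huN)
      -- Were `u` and `v` adjacent, `x` and `v` would be two common neighbours of the non-adjacent
      -- `u` and `y`.
      have := d2 (by rintro rfl; exact b3 a1) fun huv =>
        b2 (hU u y x v a2 (fun h => a3 h.symm) a1 hxy huv.symm b1.symm).symm
      simp only [hux, hvx, hvN, huA, huN, if_true, if_false]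
      linarith
    by_cases hux : u = x
    · have := d2 (hux ▸ hvx.symm) (hux ▸ b3)
      simp only [hux, hvx, hvN, hux ▸ huA, hxN, if_true, if_false] at *
      linarith
    · have := d1 (by rintro rfl; exact b3 (hu.resolve_left hux))
      simp only [hux, hvx, hvN, huA, huN, if_true, if_false]
      linarith
  · by_cases huN : u ∈ privateNeighbors G x y
    · obtain ⟨a1, a2, a3⟩ := mem_privateNeighbors.1 huN
      have hux : u ≠ x := fun h => hxN (h ▸ huN)
      by_cases hvx : v = x
      · have := d1 (hvx ▸ hux)
        have hA1 : (if u ∈ A then (1 : ℝ) else 0) ≤ 1 := by split_ifs <;> norm_num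
        simp only [hux, hvN, huN, if_true, if_false]
        rw [if_pos hvx]
        linarith
      · have : (2 : ℝ) ≤ G.dist u v := by
          rcases hv with rfl | hv
          · exact d2 a2 (fun h => a3 h.symm)
          · have hxv : G.Adj x v := by
              rw [mem_privateNeighbors] at hvN
              tauto
            refine d2 (by rintro rfl; exact a3 hv) fun huv => hxv.ne ?_
            exact hU u y x v a2 (fun h => a3 h.symm) a1 hxy huv.symm hv.symm
        have hA1 : (if u ∈ A then (1 : ℝ) else 0) ≤ 1 := by split_ifs <;> norm_num
        simp only [hux, hvx, hvN, huN, if_true, if_false]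
        linarith
    · have huA : u ∉ A := fun h => huN (hAsub u h)
      by_cases hux : u = x
      · by_cases hvx : v = x
        · simp only [huN, huA, hvN, if_false]
          rw [if_pos hux, if_pos hvx]
          linarith
        · have := d1 (hux ▸ Ne.symm hvx)
          simp only [hvx, huN, huA, hvN, if_false]
          rw [if_pos hux]
          linarith
      · simp only [hux, hvN, huA, huN, if_false]
        split_ifs <;> linarith

/-- For the potentials of `potential_sub_le` the difference of the neighbour sums is the left side
minus 1 (the 1 comes from the value 2 at `x`), and the strict inequality `< d` absorbs it. -/
lemma IsAmplyRegularWith.two_mul_card_privateNeighbors_add_le (hG : IsAmplyRegularWith G n d α 1)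
    (hκ : HasPositiveCurvature G) {x y : V} (hxy : G.Adj x y) :
    2 * (privateNeighbors G x y).card + ((privateNeighbors G x y).filter fun p =>
      ∀ q ∈ privateNeighbors G y x, 3 ≤ G.dist p q).card ≤ d := by
  set A := (privateNeighbors G x y).filter fun p =>
    ∀ q ∈ privateNeighbors G y x, 3 ≤ G.dist p q with hA
  have cx := card_privateNeighbors hG.regular hG.of_adj hxy
  have cy := card_privateNeighbors hG.regular hG.of_adj hxy.symm
  have hlt := sum_sub_sum_lt_of_curvature_pos hG.regular hxy
    (fun u => 1 + (if u = x then 1 else 0) + (if u ∈ privateNeighbors G x y then 1 else 0) +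
      (if u ∈ A then 1 else 0))
    (fun v => 1 + (if v = x then 1 else 0) - (if v ∈ privateNeighbors G y x then 1 else 0))
    ?_ ?_ (hκ x y hxy)
  · have s1 : ∑ u ∈ G.neighborFinset x, ((1 : ℝ) + (if u = x then 1 else 0) +
        (if u ∈ privateNeighbors G x y then 1 else 0) + (if u ∈ A then 1 else 0)) =
        d + (privateNeighbors G x y).card + A.card := by
      simp only [Finset.sum_add_distrib, Finset.sum_boole]
      have e1 : (G.neighborFinset x).filter (· = x) = ∅ := by
        ext z; simp only [Finset.mem_filter, SimpleGraph.mem_neighborFinset]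
        constructor
        · rintro ⟨h, rfl⟩; exact absurd h (G.loopless.irrefl _)
        · simp
      have e2 : (G.neighborFinset x).filter (· ∈ privateNeighbors G x y) =
          privateNeighbors G x y := by
        ext z; simp +contextual [mem_privateNeighbors]
      have e3 : (G.neighborFinset x).filter (· ∈ A) = A := by
        ext z; simp +contextual [hA, mem_privateNeighbors]
      rw [e1, e2, e3]
      simp [hG.regular x]
    have s2 : ∑ v ∈ G.neighborFinset y, ((1 : ℝ) + (if v = x then 1 else 0) -
        (if v ∈ privateNeighbors G y x then 1 else 0)) =
        d + 1 - (privateNeighbors G y x).card := by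
      simp only [Finset.sum_add_distrib, Finset.sum_sub_distrib, Finset.sum_boole]
      have e1 : (G.neighborFinset y).filter (· = x) = {x} := by
        ext z; simp only [Finset.mem_filter, SimpleGraph.mem_neighborFinset, Finset.mem_singleton]
        exact ⟨fun h => h.2, fun h => ⟨h ▸ hxy.symm, h⟩⟩
      have e2 : (G.neighborFinset y).filter (· ∈ privateNeighbors G y x) =
          privateNeighbors G y x := by
        ext z; simp +contextual [mem_privateNeighbors]
      rw [e1, e2]
      simp [hG.regular y]
    rw [s1, s2] at hlt
    have hm : (privateNeighbors G y x).card = (privateNeighbors G x y).card := by omega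
    rw [hm] at hlt
    have : (2 * (privateNeighbors G x y).card + A.card : ℝ) < (d + 1 : ℕ) := by
      push_cast; linarith
    exact Nat.lt_succ_iff.1 (by exact_mod_cast this)
  · simp [hA, mem_privateNeighbors, hxy.ne']
  · intro u v hu hv
    exact hG.potential_sub_le hxy (fun u h => (Finset.mem_filter.1 h).1)
      (fun u h => (Finset.mem_filter.1 h).2) hu hv

/-- If a common neighbour `w` of `x` and `z` were adjacent to `y`, then `w` and `x` would be two
common neighbours of the non-adjacent `y` and `z`. -/
lemma AtMostOneCommon.card_le_privateNeighbors (hU : AtMostOneCommon G)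
    (hα : ∀ x y, G.Adj x y → Fintype.card (G.commonNeighbors x y) = α) {x y z : V}
    (hxy : G.Adj x y) (hxz : G.Adj x z) (hyz : y ≠ z) (hnyz : ¬G.Adj y z) :
    insert z ((G.neighborFinset x).filter fun w => G.Adj z w) ⊆ privateNeighbors G x y ∧
      (insert z ((G.neighborFinset x).filter fun w => G.Adj z w)).card = α + 1 := by
  constructor
  · intro w hw
    rw [Finset.mem_insert, Finset.mem_filter, SimpleGraph.mem_neighborFinset] at hw
    rw [mem_privateNeighbors]
    rcases hw with rfl | ⟨h1, h2⟩
    · exact ⟨hxz, hyz.symm, hnyz⟩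
    · refine ⟨h1, fun h => hnyz (h ▸ h2.symm), fun h => ?_⟩
      exact h1.ne (hU y z x w hyz hnyz hxy hxz h.symm h2.symm)
  · rw [Finset.card_insert_of_notMem (by simp), card_common_finset hα hxz]

/-- Curvature gives `2 (d - 1 - α) ≤ d`. Conversely, a geodesic between non-adjacent vertices
contains an induced path on three vertices, whose edges have at least `α + 1` private neighbours, so
`d - 1 - α ≥ α + 1`. -/
lemma IsAmplyRegularWith.degree_eq (hG : IsAmplyRegularWith G n d α 1)
    (hκ : HasPositiveCurvature G) : d = 2 * (α + 1) := by
  have hU := hG.atMostOneCommon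
  obtain ⟨a, b, hab, hnab⟩ : ∃ a b, a ≠ b ∧ ¬G.Adj a b := by
    by_contra h
    push Not at h
    refine hG.not_complete ?_
    ext a b
    exact ⟨fun h => h.ne, h a b⟩
  obtain ⟨p, hp⟩ := hG.connected.exists_walk_length_eq_dist a b
  obtain ⟨u, v, w, h1, h2, h3, h4⟩ := SimpleGraph.Walk.exists_adj_adj_not_adj_ne hp
    (hG.connected.one_lt_dist_of_ne_of_not_adj hab hnab)
  have c1 := card_privateNeighbors hG.regular hG.of_adj h1.symm
  have c2 := hG.two_mul_card_privateNeighbors_add_le hκ h1.symm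
  obtain ⟨c3, c4⟩ := hU.card_le_privateNeighbors hG.of_adj h1.symm h2 h4 h3
  have c5 := Finset.card_le_card c3
  omega

/-- The neighbourhood of a vertex is the union of two cliques. -/
lemma IsAmplyRegularWith.exists_two_cliques (hG : IsAmplyRegularWith G n d α 1)
    (hκ : HasPositiveCurvature G) (x : V) :
    ∃ y z, G.Adj x y ∧ G.Adj x z ∧ y ≠ z ∧ ¬G.Adj y z ∧
      ∀ w, G.Adj x w → (w = y ∨ G.Adj y w) ∨ (w = z ∨ G.Adj z w) := by
  have hd := hG.degree_eq hκ
  have hU := hG.atMostOneCommon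
  obtain ⟨y, hy⟩ : ∃ y, G.Adj x y := by
    rw [← G.degree_pos_iff_exists_adj, hG.regular x]
    omega
  have c1 := card_privateNeighbors hG.regular hG.of_adj hy
  obtain ⟨z, hz⟩ : (privateNeighbors G x y).Nonempty := by
    rw [← Finset.card_pos]; omega
  have hz' := mem_privateNeighbors.1 hz
  refine ⟨y, z, hy, hz'.1, hz'.2.1.symm, hz'.2.2, fun w hw => ?_⟩
  obtain ⟨c3, c4⟩ := hU.card_le_privateNeighbors hG.of_adj hy hz'.1 hz'.2.1.symm hz'.2.2
  -- Both sets have `α + 1` elements, so `z` and its clique exhaust the private neighbours.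
  have heq := Finset.eq_of_subset_of_card_le c3 (by omega)
  by_cases hwy : w = y ∨ G.Adj y w
  · exact Or.inl hwy
  · right
    push Not at hwy
    have : w ∈ privateNeighbors G x y := mem_privateNeighbors.2 ⟨hw, hwy⟩
    rw [← heq] at this
    simp at this
    tauto

/-- In positive curvature, every private neighbour of `x` is at distance two from some
private neighbour of `y`. -/
lemma IsAmplyRegularWith.exists_partner (hG : IsAmplyRegularWith G n d α 1)
    (hκ : HasPositiveCurvature G) {x y p : V} (hxy : G.Adj x y) (hxp : G.Adj x p) (hpy : p ≠ y)
    (hnyp : ¬G.Adj y p) :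
    ∃ q r, G.Adj y q ∧ q ≠ x ∧ ¬G.Adj x q ∧ G.Adj p r ∧ G.Adj r q := by
  have hd := hG.degree_eq hκ
  have hU := hG.atMostOneCommon
  have c1 := card_privateNeighbors hG.regular hG.of_adj hxy
  have c2 := hG.two_mul_card_privateNeighbors_add_le hκ hxy
  -- Twice the number of private neighbours is already `d`, which leaves no room for far ones.
  have c3 : ((privateNeighbors G x y).filter fun p =>
      ∀ q ∈ privateNeighbors G y x, 3 ≤ G.dist p q).card = 0 := by omega
  rw [Finset.card_eq_zero, Finset.filter_eq_empty_iff] at c3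
  have c4 := c3 (mem_privateNeighbors.2 ⟨hxp, hpy, hnyp⟩)
  push Not at c4
  obtain ⟨q, hq, hlt⟩ := c4
  obtain ⟨b1, b2, b3⟩ := mem_privateNeighbors.1 hq
  have hpq : p ≠ q := by rintro rfl; exact b3 hxp
  have hnpq : ¬G.Adj p q := fun h =>
    b2 (hU p y x q hpy (fun h => hnyp h.symm) hxp hxy h.symm b1.symm).symm
  have := hG.connected.one_lt_dist_of_ne_of_not_adj hpq hnpq
  obtain ⟨-, -, r, hr1, hr2⟩ := (common_iff_dist_eq_two hG.connected).1
    (show G.dist p q = 2 by omega)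
  exact ⟨q, r, b1, b2, b3, hr1.symm, hr2⟩

end AmplyRegular

end LLY

/-! ### Moore graphs and the geometry of lines -/

namespace LLY

/-- A `k`-regular graph of girth at least five in which any two distinct non-adjacent vertices have
a common neighbour. -/
structure IsMooreGraph {W : Type*} (H : SimpleGraph W) (k : ℕ) : Prop where
  degree : ∀ v, (H.neighborSet v).ncard = k
  no_triangle : ∀ {a b c}, H.Adj a b → H.Adj b c → ¬H.Adj a c
  no_four_cycle : ∀ {a c b d}, a ≠ c → H.Adj b a → H.Adj b c → H.Adj d a → H.Adj d c → b = d
  exists_common : ∀ {a c}, a ≠ c → ¬H.Adj a c → ∃ b, H.Adj b a ∧ H.Adj b c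

lemma IsMooreGraph.of_iso {W W' : Type*} {H : SimpleGraph W} {H' : SimpleGraph W'} {k : ℕ}
    (h : IsMooreGraph H k) (e : H ≃g H') : IsMooreGraph H' k where
  degree v := by
    rw [← h.degree (e.symm v), ← Nat.card_coe_set_eq, ← Nat.card_coe_set_eq]
    exact Nat.card_congr (e.symm.mapNeighborSet v)
  no_triangle hab hbc hac :=
    h.no_triangle (e.symm.map_adj_iff.2 hab) (e.symm.map_adj_iff.2 hbc) (e.symm.map_adj_iff.2 hac)
  no_four_cycle hac h1 h2 h3 h4 :=
    e.symm.injective <| h.no_four_cycle (e.symm.injective.ne hac) (e.symm.map_adj_iff.2 h1)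
      (e.symm.map_adj_iff.2 h2) (e.symm.map_adj_iff.2 h3) (e.symm.map_adj_iff.2 h4)
  exists_common {a c} hac hnac := by
    obtain ⟨b, h1, h2⟩ := h.exists_common (e.symm.injective.ne hac)
      (fun h => hnac (e.symm.map_adj_iff.1 h))
    refine ⟨e b, ?_, ?_⟩
    · rw [← e.symm.map_adj_iff]; simpa using h1
    · rw [← e.symm.map_adj_iff]; simpa using h2

section Lines

variable {V : Type*} {G : SimpleGraph V}

/-- The line through two adjacent vertices: the vertices and their common neighbours. -/
def line (G : SimpleGraph V) (x y : V) : Set V := {z | z = x ∨ z = y ∨ (G.Adj x z ∧ G.Adj y z)}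

def IsLine (G : SimpleGraph V) (S : Set V) : Prop := ∃ x y, G.Adj x y ∧ S = line G x y

/-- The intersection graph of the lines. -/
def intersectionGraph (G : SimpleGraph V) : SimpleGraph {S : Set V // IsLine G S} where
  Adj S T := S ≠ T ∧ ∃ p, p ∈ S.1 ∧ p ∈ T.1
  symm := ⟨fun _ _ h => ⟨h.1.symm, h.2.imp fun _ hp => hp.symm⟩⟩
  loopless := ⟨fun _ h => h.1 rfl⟩

lemma left_mem_line (x y : V) : x ∈ line G x y := Or.inl rfl

lemma right_mem_line (x y : V) : y ∈ line G x y := Or.inr (Or.inl rfl)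

/-- Two non-adjacent points of the line would both be joined to `x` and `y`. Likewise, a common
neighbour of `a` and `b` that missed a point of the line would share both `a` and `b` with that
point. -/
lemma AtMostOneCommon.line_eq (hU : AtMostOneCommon G) {x y a b : V} (hxy : G.Adj x y)
    (ha : a ∈ line G x y) (hb : b ∈ line G x y) (hab : a ≠ b) :
    G.Adj a b ∧ line G a b = line G x y := by
  have clique : ∀ {u v}, u ∈ line G x y → v ∈ line G x y → u ≠ v → G.Adj u v := by
    rintro u v (rfl | rfl | ⟨h1, h2⟩) (rfl | rfl | ⟨h3, h4⟩) huv
    · exact absurd rfl huv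
    · exact hxy
    · exact h3
    · exact hxy.symm
    · exact absurd rfl huv
    · exact h4
    · exact h1.symm
    · exact h2.symm
    · by_contra hn
      exact hxy.ne (hU u v x y huv hn h1 h3 h2 h4)
  refine ⟨clique ha hb hab, Set.Subset.antisymm ?_ ?_⟩
  · rintro z (rfl | rfl | ⟨h1, h2⟩)
    · exact ha
    · exact hb
    · have key : ∀ {u}, u ∈ line G x y → u = z ∨ G.Adj u z := by
        intro u hu
        by_contra hn
        push Not at hn
        rcases eq_or_ne u a with rfl | hua
        · exact hn.2 h1
        rcases eq_or_ne u b with rfl | hub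
        · exact hn.2 h2
        exact hab (hU u z a b hn.1 hn.2 (clique ha hu hua.symm) h1 (clique hb hu hub.symm) h2)
      rcases key (left_mem_line x y) with h | h
      · exact Or.inl h.symm
      rcases key (right_mem_line x y) with h' | h'
      · exact Or.inr (Or.inl h'.symm)
      exact Or.inr (Or.inr ⟨h, h'⟩)
  · intro z hz
    rcases eq_or_ne z a with rfl | hza
    · exact Or.inl rfl
    rcases eq_or_ne z b with rfl | hzb
    · exact Or.inr (Or.inl rfl)
    exact Or.inr (Or.inr ⟨clique ha hz hza.symm, clique hb hz hzb.symm⟩)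

lemma AtMostOneCommon.isLine_eq_line (hU : AtMostOneCommon G) {S : Set V} (hS : IsLine G S)
    {a b : V} (ha : a ∈ S) (hb : b ∈ S) (hab : a ≠ b) : G.Adj a b ∧ S = line G a b := by
  obtain ⟨x, y, hxy, rfl⟩ := hS
  obtain ⟨h1, h2⟩ := hU.line_eq hxy ha hb hab
  exact ⟨h1, h2.symm⟩

lemma AtMostOneCommon.isLine_ext (hU : AtMostOneCommon G) {S T : Set V} (hS : IsLine G S)
    (hT : IsLine G T) {a b : V} (haS : a ∈ S) (hbS : b ∈ S) (haT : a ∈ T) (hbT : b ∈ T)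
    (hab : a ≠ b) : S = T :=
  (hU.isLine_eq_line hS haS hbS hab).2.trans (hU.isLine_eq_line hT haT hbT hab).2.symm

/-- Each neighbourhood is the union of two cliques without edges between them. -/
def LocallyTwoCliques (G : SimpleGraph V) : Prop :=
  ∀ x, ∃ y z, G.Adj x y ∧ G.Adj x z ∧ y ≠ z ∧ ¬G.Adj y z ∧
    ∀ w, G.Adj x w → (w = y ∨ G.Adj y w) ∨ (w = z ∨ G.Adj z w)

lemma exists_two_lines (hU : AtMostOneCommon G) (hT : LocallyTwoCliques G) (x : V) :
    ∃ S T : {S : Set V // IsLine G S}, S ≠ T ∧ ∀ R : {S : Set V // IsLine G S},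
      x ∈ R.1 ↔ R = S ∨ R = T := by
  obtain ⟨y, z, hy, hz, hyz, hnyz, hall⟩ := hT x
  refine ⟨⟨line G x y, x, y, hy, rfl⟩, ⟨line G x z, x, z, hz, rfl⟩, ?_, ?_⟩
  · intro h
    have h0 : line G x y = line G x z := congrArg Subtype.val h
    have h1 : y ∈ line G x z := h0 ▸ right_mem_line x y
    rcases h1 with h1 | h1 | h1
    · exact hy.ne h1.symm
    · exact hyz h1
    · exact hnyz h1.2.symm
  · rintro ⟨R, hR⟩
    constructor
    · intro hxR
      have hxR : x ∈ R := hxR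
      obtain ⟨w, hw, hxw⟩ : ∃ w, w ∈ R ∧ x ≠ w := by
        obtain ⟨a, b, hab, rfl⟩ := id hR
        by_cases h : x = a
        · exact ⟨b, right_mem_line a b, h ▸ hab.ne⟩
        · exact ⟨a, left_mem_line a b, h⟩
      have hadj := (hU.isLine_eq_line hR hxR hw hxw).1
      rcases hall w hadj with h | h
      · left
        refine Subtype.ext (hU.isLine_ext hR ⟨x, y, hy, rfl⟩ hxR hw (left_mem_line x y) ?_ hxw)
        rcases h with rfl | h
        · exact right_mem_line x w
        · exact Or.inr (Or.inr ⟨hadj, h⟩)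
      · right
        refine Subtype.ext (hU.isLine_ext hR ⟨x, z, hz, rfl⟩ hxR hw (left_mem_line x z) ?_ hxw)
        rcases h with rfl | h
        · exact right_mem_line x w
        · exact Or.inr (Or.inr ⟨hadj, h⟩)
    · rintro (h | h)
      · rw [h]; exact left_mem_line x y
      · rw [h]; exact left_mem_line x z

variable (hU : AtMostOneCommon G) (hT : LocallyTwoCliques G)

include hU hT in
lemma not_three_lines {R S T : {S : Set V // IsLine G S}} {x : V} (hR : x ∈ R.1) (hS : x ∈ S.1)
    (hT' : x ∈ T.1) (h1 : R ≠ S) (h2 : S ≠ T) (h3 : R ≠ T) : False := by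
  obtain ⟨A, B, -, h⟩ := exists_two_lines hU hT x
  have a1 := (h R).1 hR
  have a2 := (h S).1 hS
  have a3 := (h T).1 hT'
  grind

include hU hT in
-- A vertex corresponds to the pair of lines through it. Two lines meet in at most one point, which
-- gives injectivity; the point where two lines meet gives surjectivity.
lemma nonempty_iso_lineGraph : Nonempty (G ≃g (intersectionGraph G).lineGraph) := by
  have hex : ∀ x, ∃ e : (intersectionGraph G).edgeSet, ∀ L, L ∈ e.1 ↔ x ∈ L.1 := by
    intro x
    obtain ⟨S, T, hST, h⟩ := exists_two_lines hU hT x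
    refine ⟨⟨s(S, T), hST, x, (h S).2 (Or.inl rfl), (h T).2 (Or.inr rfl)⟩, fun L => ?_⟩
    rw [h L]
    exact Sym2.mem_iff
  choose f hf using hex
  have hinj : Function.Injective f := by
    intro x y hxy
    by_contra hne
    obtain ⟨S, T, hST, h⟩ := exists_two_lines hU hT x
    have hy : ∀ L : {S : Set V // IsLine G S}, x ∈ L.1 → y ∈ L.1 := fun L hL => by
      rw [← hf, ← hxy, hf]; exact hL
    have xS := (h S).2 (Or.inl rfl)
    have xT := (h T).2 (Or.inr rfl)
    exact hST (Subtype.ext (hU.isLine_ext S.2 T.2 xS (hy S xS) xT (hy T xT) hne))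
  have hsurj : Function.Surjective f := by
    rintro ⟨e, he⟩
    induction e using Sym2.ind with
    | _ S T =>
      obtain ⟨hST, p, hpS, hpT⟩ := id he
      exact ⟨p, Subtype.ext
        ((Sym2.mem_and_mem_iff hST).1 ⟨(hf p S).2 hpS, (hf p T).2 hpT⟩)⟩
  have hbij : Function.Bijective f := ⟨hinj, hsurj⟩
  refine ⟨⟨Equiv.ofBijective f hbij, ?_⟩⟩
  intro x y
  change (intersectionGraph G).lineGraph.Adj (f x) (f y) ↔ G.Adj x y
  rw [SimpleGraph.lineGraph_adj_iff_exists]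
  simp only [hf, hinj.ne_iff]
  constructor
  · rintro ⟨hxy, L, hx, hy⟩
    exact (hU.isLine_eq_line L.2 hx hy hxy).1
  · intro h
    exact ⟨h.ne, ⟨line G x y, x, y, h, rfl⟩, left_mem_line x y, right_mem_line x y⟩

include hU hT in
-- Each point of `S` lies on exactly one other line, and different points give different lines.
lemma ncard_neighborSet_intersectionGraph (S : {S : Set V // IsLine G S}) :
    ((intersectionGraph G).neighborSet S).ncard = S.1.ncard := by
  have hex : ∀ x ∈ S.1, ∃ T, S ≠ T ∧ x ∈ T.1 := by
    intro x hx
    obtain ⟨A, B, hAB, h⟩ := exists_two_lines hU hT x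
    rcases (h S).1 hx with rfl | rfl
    · exact ⟨B, hAB, (h B).2 (Or.inr rfl)⟩
    · exact ⟨A, hAB.symm, (h A).2 (Or.inl rfl)⟩
  choose f hf1 hf2 using hex
  symm
  refine Set.ncard_congr f (fun x hx => ⟨hf1 x hx, x, hx, hf2 x hx⟩) ?_ ?_
  · intro a b ha hb hab
    by_contra hne
    exact hf1 a ha (Subtype.ext (hU.isLine_ext S.2 (f a ha).2 ha hb (hf2 a ha)
      (hab ▸ hf2 b hb) hne))
  · rintro T ⟨hST, p, hpS, hpT⟩
    refine ⟨p, hpS, ?_⟩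
    by_contra hne
    exact not_three_lines hU hT (hf2 p hpS) hpS hpT (hf1 p hpS).symm hST hne

include hU hT in
-- The three meeting points are distinct and pairwise adjacent, so each lies on the line through the
-- other two, hence on three lines.
lemma intersectionGraph_no_triangle {R S T : {S : Set V // IsLine G S}}
    (h1 : (intersectionGraph G).Adj R S) (h2 : (intersectionGraph G).Adj S T) :
    ¬(intersectionGraph G).Adj R T := by
  intro h3
  obtain ⟨hRS, p, p1, p2⟩ := h1
  obtain ⟨hST, q, q1, q2⟩ := h2
  obtain ⟨hRT, r, r1, r2⟩ := h3
  have three : ∀ {x}, x ∈ R.1 → x ∈ S.1 → x ∈ T.1 → False := fun a b c =>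
    not_three_lines hU hT a b c hRS hST hRT
  have hpq : p ≠ q := by rintro rfl; exact three p1 p2 q2
  have hqr : q ≠ r := by rintro rfl; exact three r1 q1 q2
  have hpr : p ≠ r := by rintro rfl; exact three p1 p2 r2
  have e := hU.isLine_eq_line S.2 p2 q1 hpq
  refine three r1 ?_ r2
  rw [e.2]
  exact Or.inr (Or.inr ⟨(hU.isLine_eq_line R.2 p1 r1 hpr).1, (hU.isLine_eq_line T.2 q2 r2 hqr).1⟩)

include hU hT in
-- The meeting points form a quadrilateral `p q r s` with `p` and `r` not adjacent, so their common
-- neighbours `q` and `s` coincide, in a point on three lines.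
lemma intersectionGraph_no_four_cycle {a c b d : {S : Set V // IsLine G S}} (hac : a ≠ c)
    (h1 : (intersectionGraph G).Adj b a) (h2 : (intersectionGraph G).Adj b c)
    (h3 : (intersectionGraph G).Adj d a) (h4 : (intersectionGraph G).Adj d c) : b = d := by
  by_contra hbd
  obtain ⟨hba, p, pb, pa⟩ := h1
  obtain ⟨hbc, q, qb, qc⟩ := h2
  obtain ⟨hda, s, sd, sa⟩ := h3
  obtain ⟨hdc, r, rd, rc⟩ := h4
  have bcd : ∀ {x}, x ∈ b.1 → x ∈ c.1 → x ∈ d.1 → False := fun h h' h'' =>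
    not_three_lines hU hT h h' h'' hbc hdc.symm hbd
  have abc : ∀ {x}, x ∈ a.1 → x ∈ b.1 → x ∈ c.1 → False := fun h h' h'' =>
    not_three_lines hU hT h h' h'' hba.symm hbc hac
  have abd : ∀ {x}, x ∈ a.1 → x ∈ b.1 → x ∈ d.1 → False := fun h h' h'' =>
    not_three_lines hU hT h h' h'' hba.symm hbd hda.symm
  have acd : ∀ {x}, x ∈ a.1 → x ∈ c.1 → x ∈ d.1 → False := fun h h' h'' =>
    not_three_lines hU hT h h' h'' hac hdc.symm hda.symm
  have hpq : p ≠ q := by rintro rfl; exact abc pa pb qc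
  have hqr : q ≠ r := by rintro rfl; exact bcd qb qc rd
  have hrs : r ≠ s := by rintro rfl; exact acd sa rc sd
  have hsp : s ≠ p := by rintro rfl; exact abd sa pb sd
  have hpr : p ≠ r := by rintro rfl; exact abc pa pb rc
  have hnpr : ¬G.Adj p r := by
    intro h
    refine bcd ?_ rc rd
    rw [(hU.isLine_eq_line b.2 pb qb hpq).2]
    exact Or.inr (Or.inr ⟨h, (hU.isLine_eq_line c.2 qc rc hqr).1⟩)
  have hqs := hU p r q s hpr hnpr (hU.isLine_eq_line b.2 pb qb hpq).1.symm
    (hU.isLine_eq_line c.2 qc rc hqr).1 (hU.isLine_eq_line a.2 sa pa hsp).1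
    (hU.isLine_eq_line d.2 rd sd hrs).1.symm
  exact bcd qb qc (hqs ▸ sd)

/-- Every private neighbour of `x` is at distance two from a private neighbour of `y`. -/
def HasPartners (G : SimpleGraph V) : Prop :=
  ∀ {x y p : V}, G.Adj x y → G.Adj x p → p ≠ y → ¬G.Adj y p →
    ∃ q r, G.Adj y q ∧ q ≠ x ∧ ¬G.Adj x q ∧ G.Adj p r ∧ G.Adj r q

def WithinTwo {W : Type*} (H : SimpleGraph W) (a c : W) : Prop :=
  a = c ∨ H.Adj a c ∨ ∃ b, H.Adj b a ∧ H.Adj b c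

include hU hT in
-- With `p`, `x`, `y` the successive meeting points, `p` is a private neighbour of `x` with respect
-- to `y`. Its partner `q` lies on `w`, and if the middle vertex `r` lies on `a`, the line `rq`
-- meets both `a` and `w`.
lemma withinTwo_of_three_path (hP : HasPartners G) {a u v w : {S : Set V // IsLine G S}}
    (hau : (intersectionGraph G).Adj a u) (huv : (intersectionGraph G).Adj u v)
    (hvw : (intersectionGraph G).Adj v w) : WithinTwo (intersectionGraph G) a w := by
  by_cases hav : a = v
  · exact Or.inr (Or.inl (hav ▸ hvw))
  by_cases huw : u = w
  · exact Or.inr (Or.inl (huw ▸ hau))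
  obtain ⟨hau', p, pa, pu⟩ := hau
  obtain ⟨huv', x, xu, xv⟩ := huv
  obtain ⟨hvw', y, yv, yw⟩ := hvw
  have auv : ∀ {z}, z ∈ a.1 → z ∈ u.1 → z ∈ v.1 → False := fun h h' h'' =>
    not_three_lines hU hT h h' h'' hau' huv' hav
  have uvw : ∀ {z}, z ∈ u.1 → z ∈ v.1 → z ∈ w.1 → False := fun h h' h'' =>
    not_three_lines hU hT h h' h'' huv' hvw' huw
  have hxy : x ≠ y := by rintro rfl; exact uvw xu xv yw
  have hpx : p ≠ x := by rintro rfl; exact auv pa pu xv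
  have hpy : p ≠ y := by rintro rfl; exact auv pa pu yv
  obtain ⟨axy, ev⟩ := hU.isLine_eq_line v.2 xv yv hxy
  have apx := (hU.isLine_eq_line u.2 pu xu hpx).1
  have hnyp : ¬G.Adj y p := by
    intro h
    refine auv pa pu ?_
    rw [ev]
    exact Or.inr (Or.inr ⟨apx.symm, h⟩)
  obtain ⟨q, r, hyq, hqx, hnxq, hpr, hrq⟩ := hP axy apx.symm hpy hnyp
  have hqv : q ∉ v.1 := fun h => hnxq (hU.isLine_eq_line v.2 xv h hqx.symm).1
  have hqw : q ∈ w.1 := by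
    by_contra hn
    refine not_three_lines hU hT (R := v) (S := w) (T := ⟨line G y q, y, q, hyq, rfl⟩) yv yw
      (left_mem_line y q) hvw' ?_ ?_
    · intro h; exact hn (h ▸ right_mem_line y q)
    · intro h; exact hqv (h ▸ right_mem_line y q)
  by_cases hra : r ∈ a.1
  · let b : {S : Set V // IsLine G S} := ⟨line G r q, r, q, hrq, rfl⟩
    have hrb : r ∈ b.1 := left_mem_line r q
    have hqb : q ∈ b.1 := right_mem_line r q
    by_cases hba : b = a
    · by_cases haw : a = w
      · exact Or.inl haw
      · exact Or.inr (Or.inl ⟨haw, q, hba ▸ hqb, hqw⟩)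
    · by_cases hbw : b = w
      · exact Or.inr (Or.inl ⟨fun h => hba (hbw.trans h.symm), r, hra, hbw ▸ hrb⟩)
      · exact Or.inr (Or.inr ⟨b, ⟨hba, r, hrb, hra⟩, ⟨hbw, q, hqb, hqw⟩⟩)
  -- Otherwise `r` is on `u`, the other line through `p`; then `x` and `q` are two common neighbours
  -- of the non-adjacent `r` and `y`.
  · exfalso
    have hru : r ∈ u.1 := by
      by_contra hn
      refine not_three_lines hU hT (R := a) (S := u) (T := ⟨line G p r, p, r, hpr, rfl⟩) pa pu
        (left_mem_line p r) hau' ?_ ?_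
      · intro h; exact hn (h ▸ right_mem_line p r)
      · intro h; exact hra (h ▸ right_mem_line p r)
    have hrx : r ≠ x := by rintro rfl; exact hnxq hrq
    have arx := (hU.isLine_eq_line u.2 hru xu hrx).1
    have hrv : r ∉ v.1 := fun h =>
      huv' (Subtype.ext (hU.isLine_ext u.2 v.2 hru xu h xv hrx))
    have hry : r ≠ y := by rintro rfl; exact hrv yv
    have hnry : ¬G.Adj r y := by
      intro h
      apply hrv
      rw [ev]
      exact Or.inr (Or.inr ⟨arx.symm, h.symm⟩)
    exact hqx (hU r y x q hry hnry arx.symm axy hrq.symm hyq.symm).symm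

include hU hT in
lemma withinTwo_of_adj (hP : HasPartners G) {a v w : {S : Set V // IsLine G S}}
    (hav : WithinTwo (intersectionGraph G) a v) (hvw : v = w ∨ (intersectionGraph G).Adj v w) :
    WithinTwo (intersectionGraph G) a w := by
  rcases hvw with rfl | hvw
  · exact hav
  rcases hav with rfl | hav | ⟨b, hb1, hb2⟩
  · exact Or.inr (Or.inl hvw)
  · exact Or.inr (Or.inr ⟨v, hav.symm, hvw⟩)
  · exact withinTwo_of_three_path hU hT hP hb1.symm hb2 hvw

include hU hT in
-- The edges of a walk in `G` span a chain of successively meeting lines, along which `WithinTwo`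
-- propagates.
lemma withinTwo_intersectionGraph (hP : HasPartners G) (hc : G.Connected)
    (a c : {S : Set V // IsLine G S}) : WithinTwo (intersectionGraph G) a c := by
  have meet : ∀ {S T : {S : Set V // IsLine G S}} {x}, x ∈ S.1 → x ∈ T.1 →
      S = T ∨ (intersectionGraph G).Adj S T := fun {S T x} h h' => by
    by_cases hST : S = T
    · exact Or.inl hST
    · exact Or.inr ⟨hST, x, h, h'⟩
  have key : ∀ x y, G.Walk x y → ∀ S T : {S : Set V // IsLine G S}, x ∈ S.1 → y ∈ T.1 →
      WithinTwo (intersectionGraph G) T S := by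
    intro x y p
    induction p with
    | nil =>
      intro S T h h'
      exact withinTwo_of_adj hU hT hP (Or.inl rfl) (meet h' h)
    | @cons x z y hxz p ih =>
      intro S T h h'
      let R : {S : Set V // IsLine G S} := ⟨line G x z, x, z, hxz, rfl⟩
      exact withinTwo_of_adj hU hT hP (ih R T (right_mem_line x z) h')
        (meet (S := R) (left_mem_line x z) h)
  obtain ⟨x, y, -, hx⟩ := c.2
  obtain ⟨z, w, -, hz⟩ := a.2
  exact (hc x z).elim fun p => key x z p c a (hx ▸ left_mem_line x y) (hz ▸ left_mem_line z w)

include hU hT in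
lemma isMooreGraph_intersectionGraph (hP : HasPartners G) (hc : G.Connected) {k : ℕ}
    (hk : ∀ S, IsLine G S → S.ncard = k) : IsMooreGraph (intersectionGraph G) k where
  degree S := (ncard_neighborSet_intersectionGraph hU hT S).trans (hk S.1 S.2)
  no_triangle := intersectionGraph_no_triangle hU hT
  no_four_cycle := intersectionGraph_no_four_cycle hU hT
  exists_common {a c} hac hnac := by
    rcases withinTwo_intersectionGraph hU hT hP hc a c with h | h | h
    exacts [absurd h hac, absurd h hnac, h]

end Lines

/-- A positively curved amply regular graph with `β = 1` is the line graph of a Moore graph. -/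
lemma IsAmplyRegularWith.exists_moore {V : Type*} [Fintype V] {G : SimpleGraph V}
    [DecidableRel G.Adj] {n d α : ℕ} (hG : IsAmplyRegularWith G n d α 1)
    (hκ : HasPositiveCurvature G) :
    ∃ (m : ℕ) (H : SimpleGraph (Fin m)), IsMooreGraph H (α + 2) ∧ Nonempty (G ≃g H.lineGraph) ∧
      0 < m := by
  classical
  have hU := hG.atMostOneCommon
  have hT : LocallyTwoCliques G := hG.exists_two_cliques hκ
  have hP : HasPartners G := fun h1 h2 h3 h4 => hG.exists_partner hκ h1 h2 h3 h4
  have hk : ∀ S, IsLine G S → S.ncard = α + 2 := by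
    rintro S ⟨x, y, hxy, rfl⟩
    have : line G x y = ↑(insert x (insert y ((G.neighborFinset x).filter fun z => G.Adj y z))) := by
      ext z
      simp [line]
    rw [this, Set.ncard_coe_finset, Finset.card_insert_of_notMem, Finset.card_insert_of_notMem,
      card_common_finset hG.of_adj hxy]
    · simp
    · simp [hxy.ne]
  have hM := isMooreGraph_intersectionGraph hU hT hP hG.connected hk
  obtain ⟨e⟩ := nonempty_iso_lineGraph hU hT
  have : Fintype {S : Set V // IsLine G S} := Fintype.ofFinite _
  -- Relabelling by `Fin` moves the graph into `Type`, where the last alternative of the conclusion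
  -- needs it.
  let f := (intersectionGraph G).overFinIso (rfl : Fintype.card {S : Set V // IsLine G S} = _)
  refine ⟨_, _, hM.of_iso f, ⟨e.trans f.lineGraph⟩, ?_⟩
  obtain ⟨x⟩ := hG.connected.nonempty
  obtain ⟨S, -⟩ := exists_two_lines hU hT x
  exact Fintype.card_pos_iff.2 ⟨S⟩

end LLY

namespace LLY

open Matrix

/-! ### Eigenvalue multiplicities and the admissible degrees -/

section Spectrum

/-- `s⁻¹ • M` is a projection, and the trace of a projection is its rank. -/
lemma finrank_range_mul_eq_trace {W : Type*} [Fintype W] [DecidableEq W] {M : Matrix W W ℝ} {s : ℝ}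
    (hs : s ≠ 0) (hM : M * M = s • M) :
    (Module.finrank ℝ (LinearMap.range M.toLin') : ℝ) * s = M.trace := by
  have hE : IsIdempotentElem (s⁻¹ • M) := by
    rw [IsIdempotentElem, Matrix.smul_mul, Matrix.mul_smul, hM, smul_smul s⁻¹ s, inv_mul_cancel₀ hs,
      one_smul]
  have hE' : IsIdempotentElem (s⁻¹ • M).toLin' := by
    rw [IsIdempotentElem, Module.End.mul_eq_comp, ← Matrix.toLin'_mul, hE.eq]
  have ht := (LinearMap.IsIdempotentElem.isProj_range _ hE').trace
  rw [Matrix.trace_toLin'_eq, Matrix.trace_smul, map_smul,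
    LinearMap.range_smul _ _ (inv_ne_zero hs)] at ht
  rw [← ht, smul_eq_mul]
  field_simp

variable {W : Type*} [Fintype W] [DecidableEq W] {H : SimpleGraph W} [DecidableRel H.Adj] {k : ℕ}

omit [DecidableEq W] in
lemma IsMooreGraph.degree_eq (h : IsMooreGraph H k) (v : W) : H.degree v = k := by
  have := h.degree v
  rw [Set.ncard_eq_toFinset_card'] at this
  rw [← H.card_neighborFinset_eq_degree, H.neighborFinset_eq_filter]
  simpa using this

omit [DecidableEq W] in
lemma IsMooreGraph.isSRGWith (h : IsMooreGraph H k) :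
    H.IsSRGWith (Fintype.card W) k 0 1 where
  card := rfl
  regular := h.degree_eq
  of_adj v w hvw := by
    rw [Fintype.card_eq_zero_iff]
    exact ⟨fun z => h.no_triangle hvw z.2.2 z.2.1⟩
  of_not_adj v w hvw hn := by
    obtain ⟨b, h1, h2⟩ := h.exists_common hvw hn
    rw [Fintype.card_eq_one_iff]
    exact ⟨⟨b, h1.symm, h2.symm⟩, fun z =>
      Subtype.ext (h.no_four_cycle hvw z.2.1.symm z.2.2.symm h1 h2)⟩

omit [DecidableEq W] in
lemma IsMooreGraph.card_eq [Nonempty W] (h : IsMooreGraph H k) (hk : 0 < k) :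
    Fintype.card W = k ^ 2 + 1 := by
  have hn : k < Fintype.card W := by
    obtain ⟨v⟩ := ‹Nonempty W›
    rw [← h.degree_eq v]
    exact H.degree_lt_card_verts v
  have := SimpleGraph.IsSRGWith.param_eq H h.isSRGWith (by omega)
  zify [show 0 + 1 ≤ k by omega, show k + 1 ≤ Fintype.card W by omega] at this
  rw [Nat.sub_zero, Nat.sub_sub] at this
  push_cast [show 1 ≤ k by omega, show k + 1 ≤ Fintype.card W by omega] at this
  zify
  linarith

lemma IsMooreGraph.adjMatrix_sq (h : IsMooreGraph H k) :
    H.adjMatrix ℝ * H.adjMatrix ℝ = Matrix.of (fun _ _ => (1 : ℝ)) + ((k : ℝ) - 1) • 1 -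
      H.adjMatrix ℝ := by
  have h1 := h.isSRGWith.matrix_eq (α := ℝ)
  ext i j
  have h2 := congrFun (congrFun h1 i) j
  rw [sq, ← Nat.cast_smul_eq_nsmul ℝ k] at h2
  rw [h2]
  by_cases hij : i = j
  · subst hij
    simp
  · by_cases hadj : H.Adj i j <;> simp [hij, hadj, SimpleGraph.compl_adj]

omit [DecidableEq W] in
lemma IsMooreGraph.adjMatrix_mul_ones (h : IsMooreGraph H k) :
    H.adjMatrix ℝ * Matrix.of (fun _ _ => (1 : ℝ)) = (k : ℝ) • Matrix.of (fun _ _ => (1 : ℝ)) ∧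
    Matrix.of (fun _ _ => (1 : ℝ)) * H.adjMatrix ℝ = (k : ℝ) • Matrix.of (fun _ _ => (1 : ℝ)) := by
  constructor <;> ext i j
  · simp [h.degree_eq]
  · simp [h.degree_eq]

/-- By `adjMatrix_sq`, the eigenvalues off the constants are among the roots `θ` and `θ + s` of `t²
+ t - (k - 1)`. The matrix `M` kills the constants, by the choice of `c`, and the `θ`-eigenspace,
and acts as `s` on the remaining one, so its rank is the multiplicity of `θ + s`. -/
lemma IsMooreGraph.finrank_range [Nonempty W] (h : IsMooreGraph H k) (hk : 0 < k) {s θ c : ℝ}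
    (hs : s ^ 2 = 4 * k - 3) (hs0 : s ≠ 0) (hθ : 2 * θ = -1 - s)
    (hc : c * (k ^ 2 + 1) = k - θ) {M : Matrix W W ℝ}
    (hM : M = H.adjMatrix ℝ - θ • 1 - c • Matrix.of (fun _ _ => (1 : ℝ))) :
    M * M = s • M ∧
    (Module.finrank ℝ (LinearMap.range M.toLin') : ℝ) * s = -(θ * k ^ 2) - k := by
  have hcard : (Fintype.card W : ℝ) = k ^ 2 + 1 := by exact_mod_cast h.card_eq hk
  have hJJ : (Matrix.of (fun _ _ => (1 : ℝ)) : Matrix W W ℝ) * Matrix.of (fun _ _ => (1 : ℝ)) =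
      ((k : ℝ) ^ 2 + 1) • Matrix.of (fun _ _ => (1 : ℝ)) := by
    ext i j
    simp [Matrix.mul_apply, hcard]
  have hθ' : θ = (-1 - s) / 2 := by linarith
  have hmul : M * M = s • M := by
    rw [hM]
    simp only [sub_mul, mul_sub, Matrix.smul_mul, Matrix.mul_smul, one_mul, mul_one,
      h.adjMatrix_mul_ones.1, h.adjMatrix_mul_ones.2, h.adjMatrix_sq, hJJ, smul_sub, smul_smul]
    have hc1 : c * (k - θ - s) = 1 := by
      have h0 : (k : ℝ) ^ 2 + 1 ≠ 0 := by positivity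
      -- The value of `t² + t - (k - 1)` at `k`.
      have : (k - θ) * (k - θ - s) = k ^ 2 + 1 := by
        rw [hθ']
        linear_combination -(1 / 4 : ℝ) * hs
      apply mul_left_cancel₀ h0
      linear_combination (k - θ - s) * hc + this
    ext i j
    simp only [Matrix.sub_apply, Matrix.add_apply, Matrix.smul_apply, Matrix.of_apply, smul_eq_mul]
    have e1 : 2 * θ * (H.adjMatrix ℝ i j) = (-1 - s) * (H.adjMatrix ℝ i j) := by rw [hθ]
    have e2 : θ * θ = (k - 1) - θ := by
      rw [hθ']
      linear_combination (1 / 4 : ℝ) * hs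
    have e3 : (θ * θ) * (1 : Matrix W W ℝ) i j = ((k - 1) - θ) * (1 : Matrix W W ℝ) i j := by rw [e2]
    have e4 : 2 * θ * (1 : Matrix W W ℝ) i j = (-1 - s) * (1 : Matrix W W ℝ) i j := by rw [hθ]
    have e5 : θ * (2 * θ) * (1 : Matrix W W ℝ) i j = θ * (-1 - s) * (1 : Matrix W W ℝ) i j := by
      rw [hθ]
    linear_combination -e1 - e3 + e5 - hc1 + c * hc
  refine ⟨hmul, ?_⟩
  rw [finrank_range_mul_eq_trace hs0 hmul, hM]
  have hJ : (Matrix.of (fun _ _ => (1 : ℝ)) : Matrix W W ℝ).trace = k ^ 2 + 1 := by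
    simp [Matrix.trace, hcard]
  rw [Matrix.trace_sub, Matrix.trace_sub, Matrix.trace_smul, Matrix.trace_smul, hJ,
    SimpleGraph.trace_adjMatrix, Matrix.trace_one, hcard, smul_eq_mul, smul_eq_mul]
  linear_combination -hc

/-- The Hoffman–Singleton theorem. -/
theorem IsMooreGraph.degree_mem [Nonempty W] (h : IsMooreGraph H k) (hk : 2 ≤ k) :
    k = 2 ∨ k = 3 ∨ k = 7 ∨ k = 57 := by
  -- For `k = 2` the relation `he` below has right side 0 and carries no information.
  by_cases hk2 : k = 2
  · exact Or.inl hk2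
  have hkR : (2 : ℝ) ≤ k := by exact_mod_cast hk
  have hs : (Real.sqrt (4 * k - 3)) ^ 2 = 4 * k - 3 := Real.sq_sqrt (by linarith)
  have hs0 : 0 < Real.sqrt (4 * k - 3) := Real.sqrt_pos.2 (by linarith)
  set s := Real.sqrt (4 * k - 3)
  obtain ⟨-, hf⟩ := h.finrank_range (by omega) hs hs0.ne' (θ := (-1 - s) / 2)
    (c := (k - (-1 - s) / 2) / (k ^ 2 + 1)) (by ring) (by field_simp) rfl
  set f := Module.finrank ℝ (LinearMap.range (H.adjMatrix ℝ - ((-1 - s) / 2) • 1 -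
    ((k - (-1 - s) / 2) / (k ^ 2 + 1) : ℝ) • Matrix.of (fun _ _ => (1 : ℝ))).toLin')
  have he : s * ((2 * f - k ^ 2 : ℤ) : ℝ) = k * (k - 2) := by
    push_cast
    linear_combination 2 * hf
  have hsq : (4 * k - 3 : ℤ) * (2 * f - k ^ 2) ^ 2 = (k * (k - 2)) ^ 2 := by
    have : (4 * k - 3 : ℝ) * ((2 * f - k ^ 2 : ℤ) : ℝ) ^ 2 = (k * (k - 2)) ^ 2 := by
      rw [← hs, ← mul_pow, he]
    exact_mod_cast this
  have hk3 : (3 : ℤ) ≤ k := by omega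
  generalize (2 * f - k ^ 2 : ℤ) = e at hsq
  have hpos : (0 : ℤ) < (k * (k - 2)) ^ 2 := by
    have : (0 : ℤ) < k - 2 := by omega
    positivity
  have he0 : e ≠ 0 := by
    rintro rfl
    rw [← hsq] at hpos
    simp at hpos
  -- The quotient `t` is an integer square root of `4 k - 3`.
  obtain ⟨t, ht⟩ : e ∣ (k * (k - 2) : ℤ) := by
    rw [← Int.pow_dvd_pow_iff (two_ne_zero)]
    exact ⟨_, by rw [← hsq, mul_comm]⟩
  have ht2 : (4 * k - 3 : ℤ) = t ^ 2 := by
    apply mul_right_cancel₀ (pow_ne_zero 2 he0)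
    rw [hsq, ht]
    ring
  -- Substituting `4 k = t² + 3` in `16 k (k - 2) = 16 e t` gives `t⁴ - 2 t² - 15 = 16 e t`.
  have h15 : t ∣ 15 := by
    refine ⟨t ^ 3 - 2 * t - 16 * e, ?_⟩
    linear_combination (4 * k - 5 + t ^ 2 : ℤ) * ht2 - 16 * ht
  have hle : t.natAbs ≤ 15 := Nat.le_of_dvd (by norm_num) (by
    have := Int.natAbs_dvd_natAbs.2 h15
    simpa using this)
  have : t ≤ 15 ∧ -15 ≤ t := by omega
  obtain ⟨ht', ht''⟩ := this
  clear hle ht hsq hpos he0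
  interval_cases t <;> first | omega | exact absurd h15 (by decide)

end Spectrum

end LLY

namespace LLY

open Matrix

/-! ### Degree 7: splitting each half into five pentagons -/

section Components

variable {W : Type*} [Fintype W] [DecidableEq W] {H : SimpleGraph W} [DecidableRel H.Adj]

omit [DecidableEq W] in
lemma sum_neighborFinset_induce {R : Type*} [AddCommMonoid R] (X : Set W) [DecidablePred (· ∈ X)]
    (v : X) (g : W → R) :
    ∑ u ∈ (H.induce X).neighborFinset v, g u =
      ∑ u ∈ (H.neighborFinset v).filter (· ∈ X), g u := by
  have : (H.neighborFinset v).filter (· ∈ X) =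
      ((H.induce X).neighborFinset v).map (Function.Embedding.subtype (· ∈ X)) := by
    ext u
    simp
  rw [this, Finset.sum_map]
  rfl

omit [DecidableEq W] in
lemma degree_induce (X : Set W) [DecidablePred (· ∈ X)] (v : X) :
    (H.induce X).degree v = ((H.neighborFinset v).filter (· ∈ X)).card := by
  have := sum_neighborFinset_induce (H := H) X v (fun _ => 1)
  simpa using this

/-- In the Hoffman–Singleton setting, each half of a partition into two 2-regular halves has at
least five components: the eigenspace of the eigenvalue `2` has dimension `28`. -/
lemma IsMooreGraph.five_le_card_component (h : IsMooreGraph H 7) (X : Set W)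
    [DecidablePred (· ∈ X)] (hcard : Fintype.card {w // w ∉ X} = 25)
    (hX : ∀ v ∈ X, ((H.neighborFinset v).filter (· ∈ X)).card = 2)
    (hY : ∀ v ∉ X, ((H.neighborFinset v).filter (· ∉ X)).card = 2) :
    5 ≤ Nat.card (H.induce X).ConnectedComponent := by
  classical
  have hne : Nonempty W := by
    by_contra hn
    rw [not_nonempty_iff] at hn
    simp at hcard
  have hcW : Fintype.card W = 50 := h.card_eq (by norm_num)
  have hcX : Fintype.card X = 25 := by
    have := Fintype.card_subtype_compl (· ∈ X)
    have h2 := Fintype.card_subtype_le (· ∈ X)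
    rw [hcard, hcW] at this
    have h3 : Fintype.card X = Fintype.card {x // x ∈ X} := Fintype.card_congr (Equiv.refl _)
    omega
  -- For `k = 7` the eigenvalues off the constants are 2 and -3, so `s = 5` and `c = 10 / 50`; `M`
  -- is 5 times the projection onto the eigenspace of 2, of dimension `(3 * 49 - 7) / 5 = 28`.
  set M : Matrix W W ℝ := H.adjMatrix ℝ - (-3 : ℝ) • 1 -
    (1 / 5 : ℝ) • Matrix.of (fun _ _ => (1 : ℝ)) with hM
  obtain ⟨hMM, hrank⟩ := h.finrank_range (by norm_num) (s := 5) (θ := -3) (c := 1 / 5) (by norm_num)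
    (by norm_num) (by norm_num) (by norm_num) hM
  have hrank' : Module.finrank ℝ (LinearMap.range M.toLin') = 28 := by
    have : (Module.finrank ℝ (LinearMap.range M.toLin') : ℝ) = 28 := by
      push_cast at hrank; linarith
    exact_mod_cast this
  have hMapply : ∀ (v : W → ℝ) (x : W), (M *ᵥ v) x =
      ∑ u ∈ H.neighborFinset x, v u + 3 * v x - (1 / 5) * ∑ u, v u := by
    intro v x
    rw [hM, sub_mulVec, sub_mulVec, smul_mulVec, smul_mulVec, one_mulVec]
    simp only [Pi.sub_apply, Pi.smul_apply, SimpleGraph.adjMatrix_mulVec_apply, smul_eq_mul]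
    simp [mulVec, dotProduct]
  have hsymm : Mᵀ = M := by
    rw [hM]
    simp only [transpose_sub, transpose_smul, transpose_one, SimpleGraph.transpose_adjMatrix]
    rfl
  have hdual : ∀ a b : W → ℝ, a ⬝ᵥ (M *ᵥ b) = (M *ᵥ a) ⬝ᵥ b := by
    intro a b
    rw [dotProduct_mulVec, ← mulVec_transpose, hsymm]
  have hones : M *ᵥ (fun _ => (1 : ℝ)) = 0 := by
    ext x
    rw [hMapply]
    simp [h.degree_eq, hcW]
    norm_num
  -- A vertex has 2 neighbours off `X` if it is off `X` and 5 otherwise. So the indicator `g` of the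
  -- complement satisfies `A g = 5 - 3 g`: it is a constant plus an eigenvector for -3.
  have hYvec : M *ᵥ (fun w => if w ∈ X then (0 : ℝ) else 1) = 0 := by
    ext x
    have e1 : ∑ u, (if u ∈ X then (0 : ℝ) else 1) = 25 := by
      have e0 : (25 : ℝ) = (Fintype.card {w // w ∉ X} : ℕ) := by rw [hcard]; norm_num
      rw [e0, Fintype.card_subtype, ← Finset.sum_boole]
      exact Finset.sum_congr rfl fun u _ => by by_cases hu : u ∈ X <;> simp [hu]
    have e2 : ∑ u ∈ H.neighborFinset x, (if u ∈ X then (0 : ℝ) else 1) =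
        (((H.neighborFinset x).filter (· ∉ X)).card : ℝ) := by
      rw [← Finset.sum_boole]
      exact Finset.sum_congr rfl fun u _ => by by_cases hu : u ∈ X <;> simp [hu]
    rw [hMapply, e1, e2]
    by_cases hx : x ∈ X
    · have h1 := Finset.card_filter_add_card_filter_not (s := H.neighborFinset x) (· ∈ X)
      rw [hX x hx, SimpleGraph.card_neighborFinset_eq_degree, h.degree_eq] at h1
      have h2 : ((H.neighborFinset x).filter (· ∉ X)).card = 5 := by omega
      rw [h2]
      simp [hx]
      norm_num
    · rw [hY x hx]
      simp [hx]
      norm_num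
  have hprop : ∀ v ∈ LinearMap.range M.toLin', ∑ u, v u = 0 ∧
      ∑ u, (if u ∈ X then 0 else v u) = 0 ∧
      ∀ x, ∑ u ∈ H.neighborFinset x, v u = 2 * v x := by
    rintro v ⟨w, rfl⟩
    have hs : ∑ u, (M.toLin' w) u = 0 := by
      have := hdual (fun _ => 1) w
      rw [hones, zero_dotProduct] at this
      simpa [dotProduct] using this
    refine ⟨hs, ?_, ?_⟩
    · have := hdual (fun w => if w ∈ X then (0 : ℝ) else 1) w
      rw [hYvec, zero_dotProduct] at this
      simpa [dotProduct] using this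
    · intro x
      have h1 := hMapply (M.toLin' w) x
      rw [hs, toLin'_apply, mulVec_mulVec, hMM, smul_mulVec, Pi.smul_apply, smul_eq_mul] at h1
      rw [toLin'_apply]
      linarith
  set S := LinearMap.range M.toLin' with hS
  let T : S →ₗ[ℝ] ({w // w ∉ X} → ℝ) :=
    (LinearMap.funLeft ℝ ℝ (Subtype.val : {w // w ∉ X} → W)) ∘ₗ S.subtype
  -- Restriction to the 25 vertices off `X` misses the constants, because the restricted sums
  -- vanish. Its rank is at most 24, so at least 4 dimensions of eigenvectors are supported on `X`.
  have hTlt : Module.finrank ℝ (LinearMap.range T) < 25 := by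
    rw [← hcard, ← Module.finrank_fintype_fun_eq_card ℝ]
    refine Submodule.finrank_lt fun htop => ?_
    have hmem : (fun _ => (1 : ℝ)) ∈ LinearMap.range T := htop ▸ Submodule.mem_top
    obtain ⟨⟨v, hv⟩, hv'⟩ := hmem
    have h1 := (hprop v hv).2.1
    have h2 : ∀ u, (if u ∈ X then 0 else v u) = if u ∉ X then (1 : ℝ) else 0 := by
      intro u
      by_cases hu : u ∈ X
      · simp [hu]
      · have := congrFun hv' ⟨u, hu⟩
        rw [if_neg hu, if_pos hu]
        exact this
    simp only [h2, Finset.sum_boole] at h1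
    rw [← Fintype.card_subtype, hcard] at h1
    norm_num at h1
  have hker : 4 ≤ Module.finrank ℝ (LinearMap.ker T) := by
    have := T.finrank_range_add_finrank_ker
    omega
  let U : LinearMap.ker T →ₗ[ℝ] (X → ℝ) :=
    (LinearMap.funLeft ℝ ℝ (Subtype.val : X → W)) ∘ₗ S.subtype ∘ₗ (LinearMap.ker T).subtype
  have hzero : ∀ v : LinearMap.ker T, ∀ u ∉ X, (v.1.1 : W → ℝ) u = 0 := by
    intro v u hu
    exact congrFun (LinearMap.mem_ker.1 v.2) ⟨u, hu⟩
  have hUinj : Function.Injective U := by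
    intro v w hvw
    apply Subtype.ext
    apply Subtype.ext
    funext u
    by_cases hu : u ∈ X
    · exact congrFun hvw ⟨u, hu⟩
    · rw [hzero v u hu, hzero w u hu]
  -- On the 2-regular graph induced on `X`, eigenvectors for 2 are harmonic. Those in the range have
  -- sum zero, so the constants add a fifth dimension to the kernel of the Laplacian.
  have hlt : LinearMap.range U < LinearMap.ker ((H.induce X).lapMatrix ℝ).toLin' := by
    refine lt_of_le_of_ne ?_ ?_
    · rintro _ ⟨v, rfl⟩
      rw [LinearMap.mem_ker, toLin'_apply]
      ext x
      rw [SimpleGraph.lapMatrix_mulVec_apply, degree_induce, hX x x.2]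
      have h1 := sum_neighborFinset_induce (H := H) X x v.1.1
      have h2 : ∑ u ∈ (H.neighborFinset x).filter (· ∈ X), v.1.1 u =
          ∑ u ∈ H.neighborFinset x, v.1.1 u := by
        refine Finset.sum_filter_of_ne fun u _ hu => ?_
        by_contra hn
        exact hu (hzero v u hn)
      have h3 := (hprop v.1.1 v.1.2).2.2 x
      have h4 : ∑ u ∈ (H.induce X).neighborFinset x, U v u = 2 * v.1.1 x :=
        h1.trans (h2.trans h3)
      rw [h4]
      change ((2 : ℕ) : ℝ) * v.1.1 x - 2 * v.1.1 x = 0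
      push_cast
      ring
    · intro heq
      have hmem : (fun _ => (1 : ℝ)) ∈ LinearMap.range U := by
        rw [heq, LinearMap.mem_ker, toLin'_apply, SimpleGraph.lapMatrix_mulVec_const_eq_zero]
      obtain ⟨v, hv⟩ := hmem
      have h1 := (hprop v.1.1 v.1.2).1
      have h2 : ∀ u, v.1.1 u = if u ∈ X then (1 : ℝ) else 0 := by
        intro u
        by_cases hu : u ∈ X
        · have := congrFun hv ⟨u, hu⟩
          rw [if_pos hu]
          exact this
        · rw [if_neg hu, hzero v u hu]
      simp only [h2, Finset.sum_boole] at h1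
      have h5 : (Finset.univ.filter (· ∈ X)).card = 25 := by
        rw [← hcX, ← Fintype.card_subtype]
      rw [h5] at h1
      norm_num at h1
  have := Submodule.finrank_lt_finrank_of_lt hlt
  rw [LinearMap.finrank_range_of_inj hUinj,
    ← SimpleGraph.card_connectedComponent_eq_finrank_ker_toLin'_lapMatrix] at this
  rw [Nat.card_eq_fintype_card]
  omega

omit [DecidableEq W] in
/-- A component of a 2-regular subgraph has at least five vertices. -/
lemma IsMooreGraph.five_le_card_supp {k : ℕ} (h : IsMooreGraph H k) (X : Set W)
    [DecidablePred (· ∈ X)] (hX : ∀ v ∈ X, ((H.neighborFinset v).filter (· ∈ X)).card = 2)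
    (C : (H.induce X).ConnectedComponent) :
    5 ≤ Nat.card {v : X // (H.induce X).connectedComponentMk v = C} := by
  classical
  induction C using SimpleGraph.ConnectedComponent.ind with
  | _ v =>
  have two : ∀ v : X, ∃ a b : X, a ≠ b ∧ H.Adj v a ∧ H.Adj v b := by
    intro v
    obtain ⟨a, b, hab, he⟩ := Finset.card_eq_two.1 (hX v v.2)
    have ha : a ∈ (H.neighborFinset v).filter (· ∈ X) := by rw [he]; simp
    have hb : b ∈ (H.neighborFinset v).filter (· ∈ X) := by rw [he]; simp
    rw [Finset.mem_filter, SimpleGraph.mem_neighborFinset] at ha hb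
    exact ⟨⟨a, ha.2⟩, ⟨b, hb.2⟩, fun h => hab (congrArg Subtype.val h), ha.1, hb.1⟩
  have other : ∀ v u : X, ∃ a : X, a ≠ u ∧ H.Adj v a := by
    intro v u
    obtain ⟨a, b, hab, ha, hb⟩ := two v
    by_cases hau : a = u
    · exact ⟨b, fun hb => hab (hau.trans hb.symm), hb⟩
    · exact ⟨a, hau, ha⟩
  have conn : ∀ {a b : X}, H.Adj a b →
      (H.induce X).connectedComponentMk a = (H.induce X).connectedComponentMk b := by
    intro a b hab
    exact SimpleGraph.ConnectedComponent.connectedComponentMk_eq_of_adj (by simpa using hab)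
  -- Two steps away from `v` in both directions; girth five keeps the five vertices distinct.
  obtain ⟨a, b, hab, hva, hvb⟩ := two v
  obtain ⟨a', ha', haa'⟩ := other a v
  obtain ⟨b', hb', hbb'⟩ := other b v
  have n1 : a' ≠ b := fun hh => h.no_triangle hva (hh ▸ haa') hvb
  have n2 : b' ≠ a := fun hh => h.no_triangle hvb (hh ▸ hbb') hva
  have n3 : a' ≠ b' := by
    intro hh
    apply hab
    have hne : (v : W) ≠ a' := fun h => ha' (Subtype.ext h.symm)
    exact Subtype.ext (h.no_four_cycle hne hva.symm haa' hvb.symm (hh ▸ hbb'))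
  have n4 : v ≠ a := fun hh => hva.ne (congrArg Subtype.val hh)
  have n5 : v ≠ b := fun hh => hvb.ne (congrArg Subtype.val hh)
  have n6 : a ≠ a' := fun hh => haa'.ne (congrArg Subtype.val hh)
  have n7 : b ≠ b' := fun hh => hbb'.ne (congrArg Subtype.val hh)
  have hsub : ({v, a, b, a', b'} : Finset X) ⊆
      Finset.univ.filter fun u => (H.induce X).connectedComponentMk u =
        (H.induce X).connectedComponentMk v := by
    intro u hu
    rw [Finset.mem_filter]
    refine ⟨Finset.mem_univ _, ?_⟩
    simp only [Finset.mem_insert, Finset.mem_singleton] at hu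
    rcases hu with rfl | rfl | rfl | rfl | rfl
    · rfl
    · exact (conn hva).symm
    · exact (conn hvb).symm
    · exact ((conn hva).trans (conn haa')).symm
    · exact ((conn hvb).trans (conn hbb')).symm
  have h5 : ({v, a, b, a', b'} : Finset X).card = 5 := by
    rw [Finset.card_insert_of_notMem, Finset.card_insert_of_notMem, Finset.card_insert_of_notMem,
      Finset.card_insert_of_notMem, Finset.card_singleton]
    all_goals simp [*, n1.symm, n2.symm, ha'.symm, hb'.symm]
  have := Finset.card_le_card hsub
  rw [h5] at this
  rw [Nat.card_eq_fintype_card, Fintype.card_subtype]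
  exact this

/-- Each half is a disjoint union of five pentagons. -/
lemma IsMooreGraph.exists_pentagon_coloring (h : IsMooreGraph H 7) (X : Set W)
    [DecidablePred (· ∈ X)] (hcard : Fintype.card {w // w ∉ X} = 25)
    (hX : ∀ v ∈ X, ((H.neighborFinset v).filter (· ∈ X)).card = 2)
    (hY : ∀ v ∉ X, ((H.neighborFinset v).filter (· ∉ X)).card = 2) :
    ∃ c : W → ZMod 5, (∀ u ∈ X, ∀ v ∈ X, H.Adj u v → c u = c v) ∧
      ∀ i, (Finset.univ.filter fun v => v ∈ X ∧ c v = i).card = 5 := by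
  classical
  have h1 := h.five_le_card_component X hcard hX hY
  have h2 := h.five_le_card_supp X hX
  have hne : Nonempty W := by
    by_contra hn
    rw [not_nonempty_iff] at hn
    simp at hcard
  have hcX : Fintype.card X = 25 := by
    have hcW : Fintype.card W = 50 := h.card_eq (by norm_num)
    have := Fintype.card_subtype_compl (· ∈ X)
    have h2 := Fintype.card_subtype_le (· ∈ X)
    rw [hcard, hcW] at this
    have h3 : Fintype.card X = Fintype.card {x // x ∈ X} := Fintype.card_congr (Equiv.refl _)
    omega
  have hsum : ∑ C : (H.induce X).ConnectedComponent,
      Nat.card {v : X // (H.induce X).connectedComponentMk v = C} = 25 := by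
    rw [← hcX, ← Nat.card_eq_fintype_card, ← Nat.card_sigma]
    exact Nat.card_congr (Equiv.sigmaFiberEquiv _)
  rw [Nat.card_eq_fintype_card] at h1
  have hle : ∑ C : (H.induce X).ConnectedComponent, 5 ≤ ∑ C : (H.induce X).ConnectedComponent,
      Nat.card {v : X // (H.induce X).connectedComponentMk v = C} :=
    Finset.sum_le_sum fun C _ => h2 C
  have hc5 : Fintype.card (H.induce X).ConnectedComponent = 5 := by
    rw [hsum, Finset.sum_const, Finset.card_univ, smul_eq_mul] at hle
    omega
  have hfib : ∀ C, Nat.card {v : X // (H.induce X).connectedComponentMk v = C} = 5 := by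
    have heq : ∑ C : (H.induce X).ConnectedComponent, 5 = ∑ C : (H.induce X).ConnectedComponent,
        Nat.card {v : X // (H.induce X).connectedComponentMk v = C} := by
      rw [hsum, Finset.sum_const, Finset.card_univ, hc5]
      rfl
    intro C
    exact ((Finset.sum_eq_sum_iff_of_le fun C _ => h2 C).1 heq C (Finset.mem_univ _)).symm
  obtain ⟨e⟩ : Nonempty ((H.induce X).ConnectedComponent ≃ ZMod 5) :=
    ⟨Fintype.equivOfCardEq (by rw [hc5, ZMod.card])⟩
  refine ⟨fun v => if hv : v ∈ X then e ((H.induce X).connectedComponentMk ⟨v, hv⟩) else 0, ?_, ?_⟩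
  · intro u hu v hv huv
    simp only [hu, hv, dif_pos]
    congr 1
    exact SimpleGraph.ConnectedComponent.connectedComponentMk_eq_of_adj (by simpa using huv)
  · intro i
    rw [← Fintype.card_subtype]
    refine Eq.trans ?_ (hfib (e.symm i))
    rw [← Nat.card_eq_fintype_card]
    refine Nat.card_congr ⟨fun v => ⟨⟨v.1, v.2.1⟩, ?_⟩, fun v => ⟨v.1.1, v.1.2, ?_⟩,
      fun v => rfl, fun v => rfl⟩
    · have := v.2.2
      beta_reduce at this
      rw [dif_pos v.2.1] at this
      exact e.injective (this.trans (e.apply_symm_apply i).symm)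
    · beta_reduce
      rw [dif_pos v.1.2, v.2, Equiv.apply_symm_apply]

end Components

end LLY

namespace LLY

open Matrix

/-! ### Pentagons in Moore graphs and their neighbours -/

section Pentagons

variable {W : Type*} {H : SimpleGraph W} {k : ℕ}

/-- A pentagon labelled by `ZMod 5`, in which consecutive labels differ by `s`. -/
def IsPentagon (H : SimpleGraph W) (s : ZMod 5) (p : ZMod 5 → W) : Prop :=
  ∀ i j, H.Adj (p i) (p j) ↔ (j = i + s ∨ i = j + s)

lemma IsPentagon.injective {s : ZMod 5} (hs : s ≠ 0) {p : ZMod 5 → W} (hp : IsPentagon H s p) :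
    Function.Injective p := by
  intro i j hij
  have key : ∀ l, (l = i + s ∨ i = l + s) ↔ (l = j + s ∨ j = l + s) := fun l => by
    rw [← hp, ← hp, hij]
  clear hp hij p
  revert i j s
  decide

/-- A path `a' a v b` on four vertices has non-adjacent ends, and the common neighbour of these
closes it. -/
lemma IsMooreGraph.exists_pentagon (h : IsMooreGraph H k) (hk : 2 ≤ k) (v : W) :
    ∃ p : ZMod 5 → W, IsPentagon H 1 p := by
  have two : ∀ v, ∃ a b, a ≠ b ∧ H.Adj v a ∧ H.Adj v b := by
    intro v
    have := h.degree v
    obtain ⟨a, ha, b, hb, hab⟩ := (Set.one_lt_ncard (Set.finite_of_ncard_pos (by omega))).1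
      (show 1 < (H.neighborSet v).ncard by omega)
    exact ⟨a, b, hab, ha, hb⟩
  obtain ⟨a, b, hab, hva, hvb⟩ := two v
  obtain ⟨a', ha'v, haa'⟩ : ∃ a', a' ≠ v ∧ H.Adj a a' := by
    obtain ⟨x, y, hxy, hx, hy⟩ := two a
    by_cases hxv : x = v
    · exact ⟨y, fun hh => hxy (hxv.trans hh.symm), hy⟩
    · exact ⟨x, hxv, hx⟩
  have n1 : ¬H.Adj v a' := h.no_triangle hva haa'
  have n2 : ¬H.Adj a b := h.no_triangle hva.symm hvb
  have n3 : a' ≠ b := fun hh => n1 (hh ▸ hvb)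
  have n4 : ¬H.Adj a' b := fun hh =>
    hab (h.no_four_cycle ha'v.symm hva.symm haa' hvb.symm hh.symm)
  obtain ⟨e, hea', heb⟩ := h.exists_common n3 n4
  have n5 : ¬H.Adj a e := fun hh => h.no_triangle haa' hea'.symm hh
  have n6 : ¬H.Adj v e := fun hh => h.no_triangle hvb heb.symm hh
  have hadj : ∀ i j : Fin 5, H.Adj (![v, a, a', e, b] i) (![v, a, a', e, b] j) ↔
      (j = i + 1 ∨ i = j + 1) := by
    intro i j
    have m1 : ¬H.Adj a' v := fun hh => n1 hh.symm
    have m2 : ¬H.Adj b a := fun hh => n2 hh.symm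
    have m4 : ¬H.Adj b a' := fun hh => n4 hh.symm
    have m5 : ¬H.Adj e a := fun hh => n5 hh.symm
    have m6 : ¬H.Adj e v := fun hh => n6 hh.symm
    fin_cases i <;> fin_cases j <;>
      simp [hva, hvb, haa', hea', heb, n1, n2, n4, n5, n6, hva.symm, hvb.symm, haa'.symm,
        hea'.symm, heb.symm, m1, m2, m4, m5, m6]
  exact ⟨fun i => ![v, a, a', e, b] i, hadj⟩

variable [Fintype W] [DecidableEq W] [DecidableRel H.Adj]

/-- The number of neighbours of `z` in `S`. -/
def nbrCount (H : SimpleGraph W) [DecidableRel H.Adj] (S : Finset W) (z : W) : ℕ :=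
  ((H.neighborFinset z).filter (· ∈ S)).card

lemma nbrCount_pos {S : Finset W} {z : W} :
    0 < nbrCount H S z ↔ ∃ w ∈ S, H.Adj z w := by
  rw [nbrCount, Finset.card_pos]
  simp [Finset.Nonempty, and_comm]

lemma eq_of_nbrCount_le_one {S : Finset W} {z a b : W} (h : nbrCount H S z ≤ 1) (ha : a ∈ S)
    (hb : b ∈ S) (hza : H.Adj z a) (hzb : H.Adj z b) : a = b :=
  Finset.card_le_one.1 h a (by simp [ha, hza]) b (by simp [hb, hzb])

/-- The identity `A² + A = J + (k - 1) I` applied to the indicator of `S`. -/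
lemma IsMooreGraph.sum_nbrCount (h : IsMooreGraph H k) (hk : 0 < k) (S : Finset W) (q : W) :
    ∑ z ∈ H.neighborFinset q, nbrCount H S z + nbrCount H S q =
      S.card + if q ∈ S then k - 1 else 0 := by
  have hn : ∀ z, (H.adjMatrix ℝ *ᵥ fun w => if w ∈ S then (1 : ℝ) else 0) z = nbrCount H S z := by
    intro z
    rw [SimpleGraph.adjMatrix_mulVec_apply, Finset.sum_boole, nbrCount]
  have h1 := congrFun (congrArg (fun A => A *ᵥ fun w => if w ∈ S then (1 : ℝ) else 0)
    h.adjMatrix_sq) q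
  simp only [← mulVec_mulVec, sub_mulVec, add_mulVec, smul_mulVec, one_mulVec, Pi.sub_apply,
    Pi.add_apply, Pi.smul_apply, hn, smul_eq_mul] at h1
  rw [SimpleGraph.adjMatrix_mulVec_apply] at h1
  simp only [hn] at h1
  have h2 : ((Matrix.of fun _ _ => (1 : ℝ)) *ᵥ fun w => if w ∈ S then (1 : ℝ) else 0) q =
      S.card := by
    simp [mulVec, dotProduct]
  rw [h2] at h1
  have h3 : ((∑ z ∈ H.neighborFinset q, nbrCount H S z + nbrCount H S q : ℕ) : ℝ) =
      ((S.card + if q ∈ S then k - 1 else 0 : ℕ) : ℝ) := by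
    push_cast [Nat.cast_ite, Nat.cast_sub (show 1 ≤ k from hk)]
    rw [h1]
    split_ifs <;> ring
  exact_mod_cast h3

/-- A set of five vertices inducing a 2-regular graph. -/
def IsPentagonSet (H : SimpleGraph W) [DecidableRel H.Adj] (S : Finset W) : Prop :=
  S.card = 5 ∧ ∀ v ∈ S, nbrCount H S v = 2

omit [Fintype W] [DecidableRel H.Adj] in
lemma IsPentagon.card_image {s : ZMod 5} (hs : s ≠ 0) {p : ZMod 5 → W} (hp : IsPentagon H s p) :
    (Finset.univ.image p).card = 5 := by
  rw [Finset.card_image_of_injective _ (hp.injective hs), Finset.card_univ, ZMod.card]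

lemma IsPentagon.isPentagonSet {s : ZMod 5} (hs : s ≠ 0) {p : ZMod 5 → W}
    (hp : IsPentagon H s p) : IsPentagonSet H (Finset.univ.image p) := by
  refine ⟨hp.card_image hs, fun v hv => ?_⟩
  obtain ⟨i, -, rfl⟩ := Finset.mem_image.1 hv
  have : (H.neighborFinset (p i)).filter (· ∈ Finset.univ.image p) = {p (i + s), p (i - s)} := by
    ext w
    simp only [Finset.mem_filter, SimpleGraph.mem_neighborFinset, Finset.mem_image,
      Finset.mem_univ, true_and, Finset.mem_insert, Finset.mem_singleton]
    constructor
    · rintro ⟨h1, j, rfl⟩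
      rcases (hp i j).1 h1 with rfl | rfl
      · exact Or.inl rfl
      · right; congr 1; ring
    · rintro (rfl | rfl)
      · exact ⟨(hp _ _).2 (Or.inl rfl), _, rfl⟩
      · exact ⟨(hp _ _).2 (Or.inr (by ring)), _, rfl⟩
  rw [nbrCount, this, Finset.card_pair]
  refine (hp.injective hs).ne ?_
  clear this hv hp p
  revert i s
  decide

lemma sum_nbrCount_ge {S : Finset W} (hS : IsPentagonSet H S) (q : W) :
    2 * nbrCount H S q ≤ ∑ z ∈ H.neighborFinset q, nbrCount H S z := by
  calc 2 * nbrCount H S q = ∑ z ∈ (H.neighborFinset q).filter (· ∈ S), nbrCount H S z := by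
        rw [Finset.sum_congr rfl fun z hz => hS.2 z (Finset.mem_filter.1 hz).2, Finset.sum_const,
          nbrCount, smul_eq_mul, mul_comm]
    _ ≤ _ := Finset.sum_le_sum_of_subset (Finset.filter_subset _ _)

/-- Each neighbour of `q` in `S` contributes 2 to the sum in `sum_nbrCount`, so `3 * nbrCount H S q
≤ 5`. -/
lemma IsMooreGraph.nbrCount_le_one (h : IsMooreGraph H k) (hk : 0 < k) {S : Finset W}
    (hS : IsPentagonSet H S) {q : W} (hq : q ∉ S) : nbrCount H S q ≤ 1 := by
  have h1 := h.sum_nbrCount hk S q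
  have h2 := sum_nbrCount_ge hS q
  rw [hS.1, if_neg hq] at h1
  omega

/-- The neighbours of a pentagon, outside the pentagon. -/
def outerNbrs (H : SimpleGraph W) [DecidableRel H.Adj] (S : Finset W) : Finset W :=
  Finset.univ.filter fun z => z ∉ S ∧ nbrCount H S z = 1

lemma IsMooreGraph.nbrCount_eq (h : IsMooreGraph H k) (hk : 0 < k) {S : Finset W}
    (hS : IsPentagonSet H S) (z : W) :
    nbrCount H S z = (if z ∈ S then 2 else 0) + if z ∈ outerNbrs H S then 1 else 0 := by
  by_cases hz : z ∈ S
  · simp [hz, outerNbrs, hS.2 z hz]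
  · have h1 := h.nbrCount_le_one hk hS hz
    by_cases h2 : nbrCount H S z = 1
    · simp [hz, h2, outerNbrs]
    · simp only [hz, outerNbrs, Finset.mem_filter, h2]
      simp
      omega

/-- In `sum_nbrCount` a neighbour in `S` counts 2, an outer neighbour counts 1, and the others count
0. -/
lemma IsMooreGraph.nbrCount_outerNbrs (h : IsMooreGraph H k) (hk : 0 < k) {S : Finset W}
    (hS : IsPentagonSet H S) (q : W) :
    3 * nbrCount H S q + nbrCount H (outerNbrs H S) q = 5 + if q ∈ S then k - 1 else 0 := by
  have h1 := h.sum_nbrCount hk S q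
  rw [hS.1] at h1
  rw [← h1, Finset.sum_congr rfl fun z _ => h.nbrCount_eq hk hS z, Finset.sum_add_distrib,
    ← Finset.sum_filter, ← Finset.sum_filter, Finset.sum_const, Finset.sum_const]
  change _ = nbrCount H S q • 2 + nbrCount H (outerNbrs H S) q • 1 + _
  simp only [smul_eq_mul]
  ring

lemma IsMooreGraph.sum_nbrCount_univ (h : IsMooreGraph H k) (S : Finset W) :
    ∑ z, nbrCount H S z = k * S.card := by
  simp only [nbrCount, Finset.card_filter]
  have : ∀ z, (∑ i ∈ H.neighborFinset z, if i ∈ S then 1 else 0) =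
      ∑ i ∈ S, if H.Adj i z then 1 else 0 := by
    intro z
    rw [← Finset.sum_filter, ← Finset.sum_filter]
    congr 1
    ext i
    simp [and_comm, H.adj_comm]
  simp only [this]
  rw [Finset.sum_comm]
  have : ∀ i, (∑ z, if H.Adj i z then 1 else 0) = k := by
    intro i
    rw [← h.degree_eq i, ← H.card_neighborFinset_eq_degree, H.neighborFinset_eq_filter,
      Finset.card_filter]
  simp [this, mul_comm]

lemma IsMooreGraph.card_outerNbrs (h : IsMooreGraph H k) (hk : 0 < k) {S : Finset W}
    (hS : IsPentagonSet H S) : 10 + (outerNbrs H S).card = 5 * k := by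
  have h1 := h.sum_nbrCount_univ S
  rw [hS.1, Finset.sum_congr rfl fun z _ => h.nbrCount_eq hk hS z, Finset.sum_add_distrib,
    ← Finset.sum_filter, ← Finset.sum_filter, Finset.sum_const, Finset.sum_const] at h1
  simp [hS.1] at h1
  omega

lemma IsMooreGraph.nbrCount_compl (h : IsMooreGraph H k) (S : Finset W) (q : W) :
    nbrCount H S q + ((H.neighborFinset q).filter (· ∉ S)).card = k := by
  rw [nbrCount, Finset.card_filter_add_card_filter_not, H.card_neighborFinset_eq_degree,
    h.degree_eq]

/-- A pentagon `q` matched to the pentagon `p` with step `s` has step `2 * s`. -/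
lemma IsMooreGraph.isPentagon_of_matched (h : IsMooreGraph H k) {s : ZMod 5}
    (hs : s ≠ 0) {p q : ZMod 5 → W} (hp : IsPentagon H s p) {S : Finset W}
    (hS : IsPentagonSet H S) (hpS : ∀ i, p i ∉ S) (hqS : ∀ i, q i ∈ S)
    (hpq : ∀ i, H.Adj (p i) (q i)) :
    IsPentagon H (2 * s) q ∧ Finset.univ.image q = S := by
  have hinj : Function.Injective q := by
    intro i j hij
    by_contra hne
    -- Distinct vertices of a pentagon are adjacent or share a neighbour in it, so a coincidence `q
    -- i = q j` would close a triangle or a 4-cycle.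
    have : (j = i + s ∨ i = j + s) ∨
        ∃ l, (l = i + s ∨ i = l + s) ∧ (l = j + s ∨ j = l + s) := by
      clear hp hpq hij hpS hqS
      revert i j s
      decide
    rcases this with hadj | ⟨l, h1, h2⟩
    · exact h.no_triangle ((hp i j).2 hadj) (hpq j) (hij ▸ hpq i)
    · have e := h.no_four_cycle ((hp.injective hs).ne hne) ((hp i l).2 h1).symm
        ((hp j l).2 h2).symm (hpq i).symm (hij ▸ (hpq j).symm)
      exact hpS l (e ▸ hqS i)
  have himg : Finset.univ.image q = S := by
    refine Finset.eq_of_subset_of_card_le ?_ ?_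
    · intro w hw
      obtain ⟨i, -, rfl⟩ := Finset.mem_image.1 hw
      exact hqS i
    · rw [hS.1, Finset.card_image_of_injective _ hinj, Finset.card_univ, ZMod.card]
  refine ⟨?_, himg⟩
  -- Edges matched to edges would form 4-cycles. Adjacency in `q` thus needs index difference `± 2
  -- s`, and 2-regularity makes all these pairs adjacent.
  have hnot : ∀ i j, H.Adj (p i) (p j) → ¬H.Adj (q i) (q j) := by
    intro i j hij hq
    have hne : p i ≠ q j := fun hh => hpS i (hh ▸ hqS j)
    have := h.no_four_cycle hne hij.symm (hpq j) (hpq i).symm hq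
    exact hpS j (this ▸ hqS i)
  have himp : ∀ i j, H.Adj (q i) (q j) → (j = i + 2 * s ∨ i = j + 2 * s) := by
    intro i j hij
    have h1 : i ≠ j := fun hh => hij.ne (congrArg q hh)
    have h2 : ¬(j = i + s ∨ i = j + s) := fun hh => hnot i j ((hp i j).2 hh) hij
    clear hij hp hpq hpS hqS hnot himg hinj
    revert i j s
    decide
  have hsub : ∀ i, (H.neighborFinset (q i)).filter (· ∈ S) = {q (i + 2 * s), q (i - 2 * s)} := by
    intro i
    refine Finset.eq_of_subset_of_card_le ?_ ?_
    · intro w hw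
      rw [Finset.mem_filter, ← himg, SimpleGraph.mem_neighborFinset, Finset.mem_image] at hw
      obtain ⟨h1, j, -, rfl⟩ := hw
      rcases himp i j h1 with rfl | rfl
      · simp
      · simp
    · change _ ≤ nbrCount H S (q i)
      rw [hS.2 _ (hqS i)]
      exact Finset.card_le_two
  intro i j
  refine ⟨himp i j, fun hij => ?_⟩
  have hmem : q j ∈ (H.neighborFinset (q i)).filter (· ∈ S) := by
    rw [hsub i]
    rcases hij with rfl | rfl
    · simp
    · simp
  simpa using (Finset.mem_filter.1 hmem).1

end Pentagons

end LLY

namespace LLY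

/-! ### Uniqueness of the Moore graphs of degrees 2, 3 and 7 -/

section Uniqueness

/-- Five steps `± 1` returning to the start modulo 5 must all have the same sign, so `f a` is `a +
c` or `c - a`; the latter has the fixed point `3 c`. -/
lemma zmod_five_shift (f : ZMod 5 → ZMod 5) (h0 : ∀ a, f a ≠ a)
    (h1 : ∀ a, f (a + 1) = f a + 1 ∨ f (a + 1) = f a - 1) : ∃ c, ∀ a, f a = a + c := by
  have key : ∀ x0 : ZMod 5, x0 ≠ 0 → ∀ x1, x1 ≠ 1 → (x1 = x0 + 1 ∨ x1 = x0 - 1) → ∀ x2, x2 ≠ 2 →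
      (x2 = x1 + 1 ∨ x2 = x1 - 1) → ∀ x3, x3 ≠ 3 → (x3 = x2 + 1 ∨ x3 = x2 - 1) → ∀ x4, x4 ≠ 4 →
      (x4 = x3 + 1 ∨ x4 = x3 - 1) → (x0 = x4 + 1 ∨ x0 = x4 - 1) →
      x1 = 1 + x0 ∧ x2 = 2 + x0 ∧ x3 = 3 + x0 ∧ x4 = 4 + x0 := by decide
  obtain ⟨e1, e2, e3, e4⟩ := key (f 0) (h0 0) (f 1) (h0 1) (h1 0) (f 2) (h0 2) (h1 1) (f 3) (h0 3)
    (h1 2) (f 4) (h0 4) (h1 3) (h1 4)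
  refine ⟨f 0, fun a => ?_⟩
  have : a = 0 ∨ a = 1 ∨ a = 2 ∨ a = 3 ∨ a = 4 := by revert a; decide
  rcases this with rfl | rfl | rfl | rfl | rfl
  · exact (zero_add _).symm
  · exact e1
  · exact e2
  · exact e3
  · exact e4

/-- A normalized generalized Hadamard matrix of order five over `ZMod 5` is the multiplication
table. -/
lemma zmod_five_table (c : ZMod 5 → ZMod 5 → ZMod 5) (h0 : ∀ j, c 0 j = 0) (h1 : ∀ j, c 1 j = j)
    (h0' : ∀ i, c i 0 = 0) (h1' : ∀ i, c i 1 = i)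
    (hc : ∀ i i' j j', i ≠ i' → j ≠ j' → c i j - c i' j ≠ c i j' - c i' j') :
    ∀ i j, c i j = i * j := by
  -- Comparing row `h` with rows 0 and 1 alone, the entries must be distinct, and so must the
  -- entries minus their column index; this already determines the row.
  have key : ∀ h : ZMod 5, (h ≠ 0 ∧ h ≠ 1) →
      ∀ x2 : ZMod 5, (x2 ≠ 0 ∧ x2 ≠ h ∧ x2 - 2 ≠ 0 ∧ x2 - 2 ≠ h - 1) →
      ∀ x3 : ZMod 5, (x3 ≠ 0 ∧ x3 ≠ h ∧ x3 ≠ x2 ∧ x3 - 3 ≠ 0 ∧ x3 - 3 ≠ h - 1 ∧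
        x3 - 3 ≠ x2 - 2) →
      ∀ x4 : ZMod 5, (x4 ≠ 0 ∧ x4 ≠ h ∧ x4 ≠ x2 ∧ x4 ≠ x3 ∧ x4 - 4 ≠ 0 ∧ x4 - 4 ≠ h - 1 ∧
        x4 - 4 ≠ x2 - 2 ∧ x4 - 4 ≠ x3 - 3) → x2 = h * 2 ∧ x3 = h * 3 ∧ x4 = h * 4 := by decide
  intro i j
  by_cases hi0 : i = 0
  · rw [hi0, h0, zero_mul]
  by_cases hi1 : i = 1
  · rw [hi1, h1, one_mul]
  have r0 : ∀ j j', j ≠ j' → c i j ≠ c i j' := fun j j' hj => by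
    simpa [h0] using hc i 0 j j' hi0 hj
  have r1 : ∀ j j', j ≠ j' → c i j - j ≠ c i j' - j' := fun j j' hj => by
    simpa [h1] using hc i 1 j j' hi1 hj
  have a0 := h0' i
  have a1 := h1' i
  have q0 : ∀ j, j ≠ 0 → c i j ≠ 0 := fun j hj => a0 ▸ r0 j 0 hj
  have q1 : ∀ j, j ≠ 1 → c i j ≠ i := fun j hj hh => r0 j 1 hj (hh.trans a1.symm)
  have q0' : ∀ j, j ≠ 0 → c i j - j ≠ 0 := fun j hj hh =>
    r1 j 0 hj (by rw [hh, a0, sub_zero])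
  have q1' : ∀ j, j ≠ 1 → c i j - j ≠ i - 1 := fun j hj hh => r1 j 1 hj (by rw [hh, a1])
  obtain ⟨e2, e3, e4⟩ := key i ⟨hi0, hi1⟩ (c i 2) ⟨q0 2 (by decide), q1 2 (by decide),
    q0' 2 (by decide), q1' 2 (by decide)⟩ (c i 3) ⟨q0 3 (by decide), q1 3 (by decide),
    r0 3 2 (by decide), q0' 3 (by decide), q1' 3 (by decide), r1 3 2 (by decide)⟩
    (c i 4) ⟨q0 4 (by decide), q1 4 (by decide), r0 4 2 (by decide), r0 4 3 (by decide),
    q0' 4 (by decide), q1' 4 (by decide), r1 4 2 (by decide), r1 4 3 (by decide)⟩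
  have : j = 0 ∨ j = 1 ∨ j = 2 ∨ j = 3 ∨ j = 4 := by revert j; decide
  rcases this with rfl | rfl | rfl | rfl | rfl
  · rw [a0, mul_zero]
  · rw [a1, mul_one]
  · exact e2
  · exact e3
  · exact e4

variable {W : Type*} [Fintype W] [DecidableEq W] {H : SimpleGraph W} [DecidableRel H.Adj]

omit [DecidableEq W] in
lemma IsMooreGraph.nonempty_iso_cycleGraph [Nonempty W] (h : IsMooreGraph H 2) :
    Nonempty (H ≃g SimpleGraph.cycleGraph 5) := by
  obtain ⟨p, hp⟩ := h.exists_pentagon le_rfl (Classical.arbitrary W)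
  have hbij : Function.Bijective p := by
    rw [Fintype.bijective_iff_injective_and_card]
    exact ⟨hp.injective (by decide), by rw [ZMod.card, h.card_eq (by norm_num)]; norm_num⟩
  refine ⟨RelIso.symm ⟨Equiv.ofBijective p hbij, ?_⟩⟩
  intro i j
  change H.Adj (p i) (p j) ↔ _
  refine (hp i j).trans ?_
  revert i j
  change ∀ i j : Fin 5, (j = i + 1 ∨ i = j + 1) ↔ (SimpleGraph.cycleGraph 5).Adj i j
  decide

/-- The five outer neighbours of a pentagon are all the remaining vertices. They induce a 2-regular
graph matched to the pentagon, hence a pentagram in the matched labels. -/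
lemma IsMooreGraph.nonempty_iso_petersenGraph [Nonempty W] (h : IsMooreGraph H 3) :
    Nonempty (H ≃g petersenGraph) := by
  have hk : 0 < 3 := by norm_num
  obtain ⟨p, hp⟩ := h.exists_pentagon (by norm_num) (Classical.arbitrary W)
  have hP := hp.isPentagonSet (by decide)
  set P := Finset.univ.image p with hPdef
  have hmem : ∀ i, p i ∈ P := fun i => Finset.mem_image_of_mem p (Finset.mem_univ i)
  have hcard : Fintype.card W = 10 := h.card_eq (by norm_num)
  have hout : outerNbrs H P = Pᶜ := by
    refine Finset.eq_of_subset_of_card_le ?_ ?_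
    · intro z hz
      exact Finset.mem_compl.2 (Finset.mem_filter.1 hz).2.1
    · have := h.card_outerNbrs hk hP
      rw [Finset.card_compl, hcard, hP.1]
      omega
  have hS : IsPentagonSet H Pᶜ := by
    refine ⟨by rw [Finset.card_compl, hcard, hP.1], fun v hv => ?_⟩
    have h1 := h.nbrCount_outerNbrs hk hP v
    rw [hout, if_neg (Finset.mem_compl.1 hv)] at h1
    rw [← hout] at hv
    rw [(Finset.mem_filter.1 hv).2.2] at h1
    omega
  have hone : ∀ i, nbrCount H Pᶜ (p i) = 1 := by
    intro i
    have h1 := h.nbrCount_outerNbrs hk hP (p i)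
    rw [hout, if_pos (hmem i), hP.2 _ (hmem i)] at h1
    omega
  have hex : ∀ i, ∃ w ∈ Pᶜ, H.Adj (p i) w := fun i => nbrCount_pos.1 (by rw [hone]; norm_num)
  choose q hqS hpq using hex
  obtain ⟨hq, himg⟩ := h.isPentagon_of_matched (by decide) hp hS
    (fun i => by simpa using hmem i) hqS hpq
  have hqi := hq.injective (by decide)
  have hne : ∀ i j, p i ≠ q j := fun i j hh => Finset.mem_compl.1 (hqS j) (hh ▸ hmem i)
  have hpq' : ∀ i j, H.Adj (p i) (q j) ↔ j = i := fun i j =>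
    ⟨fun hh => hqi (eq_of_nbrCount_le_one (hone i).le (hqS j) (hqS i) hh (hpq i)),
      fun hh => hh ▸ hpq i⟩
  have hbij : Function.Bijective (Sum.elim p q) := by
    rw [Fintype.bijective_iff_injective_and_card]
    exact ⟨(hp.injective (by decide)).sumElim hqi hne, by simp [hcard, ZMod.card]⟩
  refine ⟨RelIso.symm ⟨Equiv.ofBijective (Sum.elim p q) hbij, ?_⟩⟩
  rintro (i | i) (j | j)
  · exact hp i j
  · exact hpq' i j
  · exact (H.adj_comm _ _).trans (hpq' j i)
  · exact hq i j

/-- Five pentagons and five pentagrams partitioning the vertices, with a perfect matching between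
every pentagon and every pentagram. -/
structure IsRobertsonSystem (H : SimpleGraph W) (P Q : ZMod 5 → ZMod 5 → W) : Prop where
  pentagon : ∀ i, IsPentagon H 1 (P i)
  pentagram : ∀ j, IsPentagon H 2 (Q j)
  not_adj_left : ∀ {i i' a a'}, i ≠ i' → ¬H.Adj (P i a) (P i' a')
  not_adj_right : ∀ {j j' b b'}, j ≠ j' → ¬H.Adj (Q j b) (Q j' b')
  cover : ∀ w, (∃ i a, P i a = w) ∨ ∃ j b, Q j b = w
  exists_adj : ∀ i j a, ∃ b, H.Adj (P i a) (Q j b)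
  unique_adj : ∀ {i j a b b'}, H.Adj (P i a) (Q j b) → H.Adj (P i a) (Q j b') → b = b'

/-- The partition of the vertices into two halves, each a disjoint union of five pentagons. -/
lemma IsMooreGraph.exists_partition (h : IsMooreGraph H 7) {S : Finset W}
    (hS : IsPentagonSet H S) :
    ∃ (Y : Finset W) (c : W → ZMod 5), Disjoint S Y ∧
      (∀ u v, (u ∈ Y ↔ v ∈ Y) → H.Adj u v → c u = c v) ∧
      (∀ i, IsPentagonSet H (Finset.univ.filter fun v => v ∉ Y ∧ c v = i)) ∧
      (∀ i, IsPentagonSet H (Finset.univ.filter fun v => v ∈ Y ∧ c v = i)) ∧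
      (∀ u ∉ Y, nbrCount H Y u = 5) ∧ ∀ u ∈ Y, ((H.neighborFinset u).filter (· ∉ Y)).card = 5 := by
  have hk : 0 < 7 := by norm_num
  set Y := outerNbrs H S with hYdef
  have hne : Nonempty W := by
    have : 0 < S.card := by rw [hS.1]; norm_num
    obtain ⟨w, -⟩ := Finset.card_pos.1 this
    exact ⟨w⟩
  have hcW : Fintype.card W = 50 := h.card_eq (by norm_num)
  have hYc : Y.card = 25 := by
    have := h.card_outerNbrs hk hS
    rw [← hYdef] at this
    omega
  -- In `nbrCount_outerNbrs`, a vertex of `S` gives `6 + n = 11`, one outside `S ∪ Y` gives `n = 5`,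
  -- and one of `Y` gives `3 + n = 5`.
  have hout : ∀ u ∉ Y, nbrCount H Y u = 5 := by
    intro u hu
    have h1 := h.nbrCount_outerNbrs hk hS u
    rw [h.nbrCount_eq hk hS, ← hYdef, if_neg hu] at h1
    split_ifs at h1 <;> omega
  have hin : ∀ u ∈ Y, nbrCount H Y u = 2 := by
    intro u hu
    have h1 := h.nbrCount_outerNbrs hk hS u
    have h2 := (Finset.mem_filter.1 hu).2
    rw [h2.2, if_neg h2.1, ← hYdef] at h1
    omega
  have hout' : ∀ u ∉ Y, ((H.neighborFinset u).filter (· ∉ Y)).card = 2 := by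
    intro u hu
    have h1 := h.nbrCount_compl Y u
    rw [hout u hu] at h1
    omega
  have hin' : ∀ u ∈ Y, ((H.neighborFinset u).filter (· ∉ Y)).card = 5 := by
    intro u hu
    have h1 := h.nbrCount_compl Y u
    rw [hin u hu] at h1
    omega
  obtain ⟨c₁, hc₁, hc₁'⟩ := h.exists_pentagon_coloring {z | z ∉ Y}
    (by simpa [Fintype.card_subtype] using hYc)
    (fun v hv => by simpa using hout' v hv)
    (fun v hv => by
      have hv' : v ∈ Y := by simpa using hv
      simpa [nbrCount] using hin v hv')
  obtain ⟨c₂, hc₂, hc₂'⟩ := h.exists_pentagon_coloring {z | z ∈ Y}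
    (by
      have h2 : Fintype.card {w // w ∉ Y} = 25 := by
        rw [Fintype.card_subtype_compl, hcW, Fintype.card_coe, hYc]
      simpa using h2)
    (fun v hv => hin v hv) (fun v hv => hout' v hv)
  refine ⟨Y, fun w => if w ∈ Y then c₂ w else c₁ w, ?_, ?_, ?_, ?_, hout, hin'⟩
  · rw [Finset.disjoint_left]
    intro w hw hw'
    exact (Finset.mem_filter.1 hw').2.1 hw
  · intro u v huv hadj
    by_cases hu : u ∈ Y
    · have hv := huv.1 hu
      simp only [hu, hv, if_true]
      exact hc₂ u hu v hv hadj
    · have hv : v ∉ Y := fun hv => hu (huv.2 hv)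
      simp only [hu, hv, if_false]
      exact hc₁ u hu v hv hadj
  · intro i
    constructor
    · refine Eq.trans ?_ (hc₁' i)
      congr 1
      ext v
      by_cases hv : v ∈ Y <;> simp [hv]
    · intro v hv
      obtain ⟨-, hvY, hvi⟩ := Finset.mem_filter.1 hv
      rw [← hout' v hvY, nbrCount]
      congr 1
      ext w
      simp only [Finset.mem_filter, Finset.mem_univ, true_and, SimpleGraph.mem_neighborFinset]
      refine and_congr_right fun hvw => ⟨fun hh => hh.1, fun hwY => ⟨hwY, ?_⟩⟩
      rw [if_neg hwY, ← hc₁ v hvY w hwY hvw]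
      simpa [hvY] using hvi
  · intro i
    constructor
    · refine Eq.trans ?_ (hc₂' i)
      congr 1
      ext v
      by_cases hv : v ∈ Y <;> simp [hv]
    · intro v hv
      obtain ⟨-, hvY, hvi⟩ := Finset.mem_filter.1 hv
      rw [← hin v hvY, nbrCount, nbrCount]
      congr 1
      ext w
      simp only [Finset.mem_filter, Finset.mem_univ, true_and, SimpleGraph.mem_neighborFinset]
      refine and_congr_right fun hvw => ⟨fun hh => hh.1, fun hwY => ⟨hwY, ?_⟩⟩
      rw [if_pos hwY, ← hc₂ v hvY w hwY hvw]
      simpa [hvY] using hvi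

omit [Fintype W] [DecidableEq W] in
lemma card_filter_eq_sum_color {c : W → ZMod 5} (s : Finset W) (p : W → Prop) [DecidablePred p] :
    (s.filter p).card = ∑ i, (s.filter fun w => p w ∧ c w = i).card := by
  rw [Finset.card_eq_sum_card_fiberwise (f := c) (t := Finset.univ) (fun _ _ => by simp)]
  refine Finset.sum_congr rfl fun i _ => ?_
  rw [Finset.filter_filter]

lemma all_eq_one_of_sum {f : ZMod 5 → ℕ} (hf : ∀ i, f i ≤ 1) (hs : ∑ i, f i = 5) (i : ZMod 5) :
    f i = 1 := by
  have heq : ∑ i, f i = ∑ _i : ZMod 5, 1 := by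
    rw [hs, Finset.sum_const, Finset.card_univ, ZMod.card]
    rfl
  exact (Finset.sum_eq_sum_iff_of_le fun i _ => hf i).1 heq i (Finset.mem_univ i)

/-- A vertex has five neighbours in the opposite half and at most one in each of its five pentagons,
hence exactly one in each. Matching transports the labels of one pentagon to every `Q j`, and those
of `Q 0` to every `P i`; the initial pentagon gets its own labels back. -/
lemma IsMooreGraph.exists_robertsonSystem [Nonempty W] (h : IsMooreGraph H 7) :
    ∃ (P Q : ZMod 5 → ZMod 5 → W) (i₀ j₀ : ZMod 5), IsRobertsonSystem H P Q ∧
      (∀ j a, H.Adj (P i₀ a) (Q j a)) ∧ ∀ i a, H.Adj (P i a) (Q j₀ a) := by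
  have hk : 0 < 7 := by norm_num
  obtain ⟨p, hp⟩ := h.exists_pentagon (by norm_num) (Classical.arbitrary W)
  have hP := hp.isPentagonSet (by decide)
  obtain ⟨Y, c, hdisj, hc, hS, hT, hout, hin⟩ := h.exists_partition hP
  set S : ZMod 5 → Finset W := fun i => Finset.univ.filter fun v => v ∉ Y ∧ c v = i with hSdef
  set T : ZMod 5 → Finset W := fun i => Finset.univ.filter fun v => v ∈ Y ∧ c v = i with hTdef
  have memS : ∀ {i v}, v ∈ S i ↔ v ∉ Y ∧ c v = i := by simp [hSdef]
  have memT : ∀ {i v}, v ∈ T i ↔ v ∈ Y ∧ c v = i := by simp [hTdef]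
  have hT1 : ∀ u ∉ Y, ∀ j, nbrCount H (T j) u = 1 := by
    intro u hu
    refine all_eq_one_of_sum
      (fun j => h.nbrCount_le_one hk (hT j) fun hh => hu (memT.1 hh).1) ?_
    refine Eq.trans ?_ (hout u hu)
    rw [nbrCount, card_filter_eq_sum_color (c := c)]
    simp only [nbrCount, memT]
  have hS1 : ∀ u ∈ Y, ∀ i, nbrCount H (S i) u = 1 := by
    intro u hu
    refine all_eq_one_of_sum
      (fun j => h.nbrCount_le_one hk (hS j) fun hh => (memS.1 hh).1 hu) ?_
    refine Eq.trans ?_ (hin u hu)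
    rw [card_filter_eq_sum_color (c := c)]
    simp only [nbrCount, memS]
  have hpY : ∀ a, p a ∉ Y := fun a =>
    Finset.disjoint_left.1 hdisj (Finset.mem_image_of_mem p (Finset.mem_univ a))
  have hcp : ∀ a, c (p a) = c (p 0) := by
    have step : ∀ a, c (p (a + 1)) = c (p a) := fun a =>
      (hc _ _ (by simp [hpY]) ((hp a (a + 1)).2 (Or.inl rfl))).symm
    intro a
    have s0 := step 0
    have s1 := step 1
    have s2 := step 2
    have s3 := step 3
    have : a = 0 ∨ a = 0 + 1 ∨ a = 1 + 1 ∨ a = 2 + 1 ∨ a = 3 + 1 := by revert a; decide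
    rcases this with rfl | rfl | rfl | rfl | rfl
    · rfl
    · exact s0
    · exact s1.trans s0
    · exact s2.trans (s1.trans s0)
    · exact s3.trans (s2.trans (s1.trans s0))
  have hexQ : ∀ j a, ∃ w ∈ T j, H.Adj (p a) w := fun j a =>
    nbrCount_pos.1 (by rw [hT1 _ (hpY a)]; norm_num)
  choose Q hQT hpQ using hexQ
  have hQ : ∀ j, IsPentagon H 2 (Q j) ∧ Finset.univ.image (Q j) = T j := fun j =>
    h.isPentagon_of_matched (by decide) hp (hT j) (fun a hh => hpY a (memT.1 hh).1) (hQT j)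
      (hpQ j)
  have hQY : ∀ j a, Q j a ∈ Y := fun j a => (memT.1 (hQT j a)).1
  have hexP : ∀ i a, ∃ w ∈ S i, H.Adj (Q 0 a) w := fun i a =>
    nbrCount_pos.1 (by rw [hS1 _ (hQY 0 a)]; norm_num)
  choose P hPS hQP using hexP
  have hP' : ∀ i, IsPentagon H (2 * 2) (P i) ∧ Finset.univ.image (P i) = S i := fun i =>
    h.isPentagon_of_matched (by decide) (hQ 0).1 (hS i)
      (fun a hh => (memS.1 hh).1 (hQY 0 a)) (hPS i) (hQP i)
  have hPY : ∀ i a, P i a ∉ Y := fun i a => (memS.1 (hPS i a)).1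
  have hPp : ∀ a, P (c (p 0)) a = p a := fun a =>
    eq_of_nbrCount_le_one (hS1 _ (hQY 0 a) (c (p 0))).le (hPS _ a)
      (memS.2 ⟨hpY a, hcp a⟩) (hQP _ a) (hpQ 0 a).symm
  refine ⟨P, Q, c (p 0), 0, ⟨?_, fun j => (hQ j).1, ?_, ?_, ?_, ?_, ?_⟩, ?_, ?_⟩
  · intro i a b
    -- Doubling the step twice gives `4 = -1`, which is the same pentagon as step 1.
    rw [(hP' i).1]
    revert a b
    decide
  · intro i i' a a' hne hadj
    have := hc _ _ (by simp [hPY]) hadj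
    rw [(memS.1 (hPS i a)).2, (memS.1 (hPS i' a')).2] at this
    exact hne this
  · intro i i' a a' hne hadj
    have := hc _ _ (by simp [hQY]) hadj
    rw [(memT.1 (hQT i a)).2, (memT.1 (hQT i' a')).2] at this
    exact hne this
  · intro w
    by_cases hw : w ∈ Y
    · right
      have : w ∈ T (c w) := memT.2 ⟨hw, rfl⟩
      rw [← (hQ (c w)).2] at this
      obtain ⟨b, -, hb⟩ := Finset.mem_image.1 this
      exact ⟨_, b, hb⟩
    · left
      have : w ∈ S (c w) := memS.2 ⟨hw, rfl⟩
      rw [← (hP' (c w)).2] at this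
      obtain ⟨b, -, hb⟩ := Finset.mem_image.1 this
      exact ⟨_, b, hb⟩
  · intro i j a
    obtain ⟨w, hw, hadj⟩ := nbrCount_pos.1
      (show 0 < nbrCount H (T j) (P i a) by rw [hT1 _ (hPY i a)]; norm_num)
    rw [← (hQ j).2] at hw
    obtain ⟨b, -, rfl⟩ := Finset.mem_image.1 hw
    exact ⟨b, hadj⟩
  · intro i j a b b' hb hb'
    exact (hQ j).1.injective (by decide)
      (eq_of_nbrCount_le_one (hT1 _ (hPY i a) j).le (hQT j b) (hQT j b') hb hb')
  · intro j a
    rw [hPp]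
    exact hpQ j a
  · intro i a
    exact (hQP i a).symm

/-- The vertex labelled by an index of Robertson's construction. -/
def robertsonMap {W : Type*} (P Q : ZMod 5 → ZMod 5 → W) :
    (ZMod 5 × ZMod 5) ⊕ (ZMod 5 × ZMod 5) → W :=
  Sum.elim (fun x => P x.1 x.2) fun x => Q x.1 x.2

omit [DecidableEq W] [DecidableRel H.Adj] in
lemma IsRobertsonSystem.bijective {P Q : ZMod 5 → ZMod 5 → W} (hR : IsRobertsonSystem H P Q)
    (hcard : Fintype.card W = 50) : Function.Bijective (robertsonMap P Q) := by
  rw [Fintype.bijective_iff_surjective_and_card]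
  refine ⟨fun w => ?_, by simp [hcard, ZMod.card]⟩
  rcases hR.cover w with ⟨i, a, rfl⟩ | ⟨j, b, rfl⟩
  · exact ⟨Sum.inl (i, a), rfl⟩
  · exact ⟨Sum.inr (j, b), rfl⟩

omit [DecidableEq W] [DecidableRel H.Adj] in
lemma IsRobertsonSystem.nonempty_iso {P Q : ZMod 5 → ZMod 5 → W} (hR : IsRobertsonSystem H P Q)
    (hcard : Fintype.card W = 50) (hadj : ∀ i j a, H.Adj (P i a) (Q j (a + i * j))) :
    Nonempty (H ≃g hoffmanSingletonGraph) := by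
  have hPQ : ∀ i j a b, H.Adj (P i a) (Q j b) ↔ b = i * j + a := by
    intro i j a b
    rw [add_comm]
    exact ⟨fun hh => hR.unique_adj hh (hadj i j a), fun hh => hh ▸ hadj i j a⟩
  refine ⟨RelIso.symm ⟨Equiv.ofBijective _ (hR.bijective hcard), ?_⟩⟩
  rintro (⟨i, a⟩ | ⟨i, a⟩) (⟨j, b⟩ | ⟨j, b⟩)
  · change H.Adj (P i a) (P j b) ↔ i = j ∧ (b = a + 1 ∨ a = b + 1)
    by_cases hij : i = j
    · subst hij
      simp [hR.pentagon i a b]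
    · simp [hij, hR.not_adj_left hij]
  · exact hPQ i j a b
  · exact (H.adj_comm _ _).trans (hPQ j i b a)
  · change H.Adj (Q i a) (Q j b) ↔ i = j ∧ (b = a + 2 ∨ a = b + 2)
    by_cases hij : i = j
    · subst hij
      simp [hR.pentagram i a b]
    · simp [hij, hR.not_adj_right hij]

omit [Fintype W] [DecidableEq W] [DecidableRel H.Adj] in
lemma IsRobertsonSystem.reindex {P Q : ZMod 5 → ZMod 5 → W} (hR : IsRobertsonSystem H P Q)
    (σ τ : Equiv.Perm (ZMod 5)) : IsRobertsonSystem H (fun i => P (σ i)) fun j => Q (τ j) where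
  pentagon i := hR.pentagon (σ i)
  pentagram j := hR.pentagram (τ j)
  not_adj_left h := hR.not_adj_left (σ.injective.ne h)
  not_adj_right h := hR.not_adj_right (τ.injective.ne h)
  cover w := by
    rcases hR.cover w with ⟨i, a, h⟩ | ⟨j, b, h⟩
    · exact Or.inl ⟨σ.symm i, a, by simpa using h⟩
    · exact Or.inr ⟨τ.symm j, b, by simpa using h⟩
  exists_adj i j a := hR.exists_adj (σ i) (τ j) a
  unique_adj h h' := hR.unique_adj h h'

/-- Each matching from `P i` to `Q j` is a shift by some `c i j`. Absence of 4-cycles makes `c` a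
generalized Hadamard matrix, which relabelling the pentagons and pentagrams turns into the
multiplication table. -/
lemma IsMooreGraph.nonempty_iso_hoffmanSingletonGraph [Nonempty W] (h : IsMooreGraph H 7) :
    Nonempty (H ≃g hoffmanSingletonGraph) := by
  have hcard : Fintype.card W = 50 := h.card_eq (by norm_num)
  obtain ⟨P, Q, i₀, j₀, hR, hi₀, hj₀⟩ := h.exists_robertsonSystem
  have hinj := (hR.bijective hcard).injective
  have hPP : ∀ {i i' a a'}, i ≠ i' → P i a ≠ P i' a' := fun {i i' a a'} hne hh => hne (by
    have := @hinj (Sum.inl (i, a)) (Sum.inl (i', a')) hh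
    simp_all)
  have hQQ : ∀ {j j' b b'}, j ≠ j' → Q j b ≠ Q j' b' := fun {i i' a a'} hne hh => hne (by
    have := @hinj (Sum.inr (i, a)) (Sum.inr (i', a')) hh
    simp_all)
  have hPQ : ∀ {i j a b}, P i a ≠ Q j b := fun {i j a b} hh => by
    have := @hinj (Sum.inl (i, a)) (Sum.inr (j, b)) hh
    simp_all
  have hshift : ∀ i j, ∃ c, (∀ a, H.Adj (P i a) (Q j (a + c))) ∧ (i = i₀ → c = 0) ∧
      (j = j₀ → c = 0) := by
    intro i j
    by_cases hi : i = i₀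
    · exact ⟨0, fun a => by rw [add_zero, hi]; exact hi₀ j a, fun _ => rfl, fun _ => rfl⟩
    by_cases hj : j = j₀
    · exact ⟨0, fun a => by rw [add_zero, hj]; exact hj₀ i a, fun _ => rfl, fun _ => rfl⟩
    choose f hf using hR.exists_adj i j
    -- A fixed point would close the 4-cycle `P i a`, `Q j a`, `P i₀ a`, `Q j₀ a`.
    have hfix : ∀ a, f a ≠ a := by
      intro a hfa
      have hq := hf a
      rw [hfa] at hq
      exact hQQ hj (h.no_four_cycle (hPP hi) hq.symm (hi₀ j a).symm (hj₀ i a).symm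
        (hj₀ i₀ a).symm)
    -- The images of adjacent vertices are distinct (no triangle) and not adjacent (no 4-cycle); in
    -- a pentagram this leaves a difference of `± 1`.
    have hstep : ∀ a, f (a + 1) = f a + 1 ∨ f (a + 1) = f a - 1 := by
      intro a
      have hadj : H.Adj (P i a) (P i (a + 1)) := (hR.pentagon i a (a + 1)).2 (Or.inl rfl)
      have n1 : f (a + 1) ≠ f a := fun hh =>
        h.no_triangle hadj (hf (a + 1)) (hh ▸ hf a)
      have n2 : ¬(f (a + 1) = f a + 2 ∨ f a = f (a + 1) + 2) := fun hh => by
        have hq := (hR.pentagram j (f a) (f (a + 1))).2 hh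
        exact hPQ (h.no_four_cycle hPQ hadj.symm (hf (a + 1)) (hf a).symm hq)
      generalize f (a + 1) = x at n1 n2
      generalize f a = y at n1 n2
      clear * - n1 n2
      revert x y
      decide
    obtain ⟨c, hc⟩ := zmod_five_shift f hfix hstep
    exact ⟨c, fun a => hc a ▸ hf a, fun hh => absurd hh hi, fun hh => absurd hh hj⟩
  choose c hc hc0 hc0' using hshift
  -- Equality would give `P i 0` and `P i' (c i j - c i' j)` common neighbours in both `Q j` and `Q
  -- j'`.
  have hfour : ∀ i i' j j', i ≠ i' → j ≠ j' → c i j - c i' j ≠ c i j' - c i' j' := by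
    intro i i' j j' hi hj heq
    have a1 := hc i j 0
    have a2 := hc i j' 0
    have a3 := hc i' j (c i j - c i' j)
    have a4 := hc i' j' (c i j - c i' j)
    rw [zero_add] at a1 a2
    rw [sub_add_cancel] at a3
    rw [heq, sub_add_cancel, ← heq] at a4
    exact hQQ hj (h.no_four_cycle (hPP hi) a1.symm a3.symm a2.symm a4.symm)
  have z1 : ∀ j, c i₀ j = 0 := fun j => hc0 i₀ j rfl
  have z2 : ∀ i, c i j₀ = 0 := fun i => hc0' i j₀ rfl
  have hj1 : j₀ + 1 ≠ j₀ := by clear * -; revert j₀; decide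
  -- Any column other than the zero column `j₀` would serve. It relabels the pentagons, and the row
  -- then numbered 1 relabels the pentagrams; the second step keeps column 1 normalized because `c
  -- (σ.symm 1) (j₀ + 1) = 1`.
  have hσ : Function.Injective fun i => c i (j₀ + 1) := by
    intro i i' hii
    by_contra hne
    refine hfour i i' (j₀ + 1) j₀ hne hj1 ?_
    rw [z2, z2]
    simpa [sub_eq_zero] using hii
  let σ : Equiv.Perm (ZMod 5) := Equiv.ofBijective _ (Finite.injective_iff_bijective.1 hσ)
  have hσ' : ∀ i, c (σ.symm i) (j₀ + 1) = i := fun i => σ.apply_symm_apply i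
  have hi1 : σ.symm 1 ≠ i₀ := by
    intro hh
    have := hσ' 1
    rw [hh, z1] at this
    exact absurd this (by decide)
  have hτ : Function.Injective fun j => c (σ.symm 1) j := by
    intro j j' hjj
    by_contra hne
    refine hfour (σ.symm 1) i₀ j j' hi1 hne ?_
    rw [z1, z1]
    simpa using hjj
  let τ : Equiv.Perm (ZMod 5) := Equiv.ofBijective _ (Finite.injective_iff_bijective.1 hτ)
  have hτ' : ∀ j, c (σ.symm 1) (τ.symm j) = j := fun j => τ.apply_symm_apply j
  have e1 : τ.symm 1 = j₀ + 1 := by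
    rw [Equiv.symm_apply_eq]
    exact (hσ' 1).symm
  have e2 : τ.symm 0 = j₀ := by
    rw [Equiv.symm_apply_eq]
    exact (z2 _).symm
  have e3 : σ.symm 0 = i₀ := by
    rw [Equiv.symm_apply_eq]
    exact (z1 _).symm
  have htable := zmod_five_table (fun i j => c (σ.symm i) (τ.symm j))
    (fun j => by rw [e3, z1]) hτ' (fun i => by rw [e2, z2]) (fun i => by rw [e1, hσ'])
    fun i i' j j' hi hj => hfour _ _ _ _ (σ.symm.injective.ne hi) (τ.symm.injective.ne hj)
  refine (hR.reindex σ.symm τ.symm).nonempty_iso hcard fun i j a => ?_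
  rw [← htable i j]
  exact hc _ _ a

/-- The line graph of the pentagon is the pentagon. -/
lemma nonempty_iso_lineGraph_cycleGraph_five :
    Nonempty ((SimpleGraph.cycleGraph 5).lineGraph ≃g SimpleGraph.cycleGraph 5) := by
  have hmem : ∀ i : Fin 5, s(i, i + 1) ∈ (SimpleGraph.cycleGraph 5).edgeSet := by decide
  let f : Fin 5 → (SimpleGraph.cycleGraph 5).edgeSet := fun i => ⟨s(i, i + 1), hmem i⟩
  have hinj : Function.Injective f := by
    intro i j hij
    have h1 : s(i, i + 1) = s(j, j + 1) := congrArg Subtype.val hij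
    clear hij
    revert i j
    decide
  have hsurj : Function.Surjective f := by
    rintro ⟨e, he⟩
    induction e using Sym2.ind with
    | _ a b =>
      have : ∀ a b : Fin 5, (SimpleGraph.cycleGraph 5).Adj a b →
          ∃ i : Fin 5, s(i, i + 1) = s(a, b) := by decide
      obtain ⟨i, hi⟩ := this a b he
      exact ⟨i, Subtype.ext hi⟩
  have hbij : Function.Bijective f := ⟨hinj, hsurj⟩
  refine ⟨RelIso.symm ⟨Equiv.ofBijective f hbij, ?_⟩⟩
  intro i j
  change (SimpleGraph.cycleGraph 5).lineGraph.Adj (f i) (f j) ↔ _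
  rw [SimpleGraph.lineGraph_adj_iff_exists, hinj.ne_iff]
  change (i ≠ j ∧ ∃ v, v ∈ s(i, i + 1) ∧ v ∈ s(j, j + 1)) ↔ _
  simp only [Sym2.mem_iff]
  revert i j
  decide

end Uniqueness

end LLY

/-! ### The classification -/

theorem corollary3p4 {V : Type*} [Fintype V] (G : SimpleGraph V) [DecidableRel G.Adj]
    (n d α : ℕ) (hG : LLY.IsAmplyRegularWith G n d α 1) (hκ : LLY.HasPositiveCurvature G) :
    Nonempty (G ≃g SimpleGraph.cycleGraph 5) ∨
    Nonempty (G ≃g LLY.petersenGraph.lineGraph) ∨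
    Nonempty (G ≃g LLY.hoffmanSingletonGraph.lineGraph) ∨
    ∃ (W : Type) (_ : Fintype W) (H : SimpleGraph W) (_ : DecidableRel H.Adj),
      H.IsSRGWith 3250 57 0 1 ∧ Nonempty (G ≃g H.lineGraph) := by
  classical
  obtain ⟨m, H, hH, ⟨e⟩, hm⟩ := hG.exists_moore hκ
  have : Nonempty (Fin m) := ⟨⟨0, hm⟩⟩
  -- The degree is `α + 2`, so `α` is 0, 1, 5 or 55; the pentagon appears in the first case because
  -- it is its own line graph.
  rcases hH.degree_mem (by omega) with hk | hk | hk | hk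
  · rw [hk] at hH
    obtain ⟨f⟩ := hH.nonempty_iso_cycleGraph
    obtain ⟨g⟩ := LLY.nonempty_iso_lineGraph_cycleGraph_five
    exact Or.inl ⟨e.trans (f.lineGraph.trans g)⟩
  · rw [hk] at hH
    obtain ⟨f⟩ := hH.nonempty_iso_petersenGraph
    exact Or.inr (Or.inl ⟨e.trans f.lineGraph⟩)
  · rw [hk] at hH
    obtain ⟨f⟩ := hH.nonempty_iso_hoffmanSingletonGraph
    exact Or.inr (Or.inr (Or.inl ⟨e.trans f.lineGraph⟩))
  · rw [hk] at hH
    have hcard : Fintype.card (Fin m) = 3250 := hH.card_eq (by norm_num)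
    exact Or.inr (Or.inr (Or.inr ⟨Fin m, inferInstance, H, inferInstance,
      hcard ▸ hH.isSRGWith, ⟨e⟩⟩))
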